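/- Let $G$ be a near-triangulation, that is, a finite connected simple plane graph whose outer face is bounded by a cycle (the boundary cycle) and all of whose other faces are bounded by triangles; plane graphs are taken combinatorially, as rotation systems satisfying Euler's formula $|V|-|E|+|F|=2$ with a chosen outer face. Vertices on the boundary cycle are called boundary vertices, and all other vertices are called interior vertices. Fix a linear ordering $x_1,\dots,x_n$ of the vertices of $G$ and use the vertices as variables. Let $e=xy$ be any edge of the boundary cycle. Let $\mathbb{F}$ be any field, and for each edge $f$ of $G-e$ let $a_f,b_f\in\mathbb{F}$ be arbitrary non-zero elements. Then the decorated graph polynomial $$D_{G-e}(x_1,\dots,x_n)=\prod_{f=x_ix_j\in E(G-e),\ i<j}(a_f x_i+b_f x_j)\in\mathbb{F}[x_1,\dots,x_n]$$ contains a monomial $M$ with non-zero coefficient such that (i) $\deg_x(M)=\deg_y(M)=0$; (ii) $\deg_v(M)\leq 2$ for every boundary vertex $v$; (iii) $\deg_u(M)\leq 4$ for every interior vertex $u$. -/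

import Mathlib

/-- A rotation system (combinatorial embedding) of a simple graph: a permutation `next` of the
darts (oriented edges) of `G` which, for every vertex `v`, permutes the darts leaving `v` in one
single cycle. It records the clockwise order of the edges around each vertex. -/
structure RotationSystem {V : Type*} (G : SimpleGraph V) where
  next : Equiv.Perm G.Dart
  sameCycle_iff : ∀ d d' : G.Dart, next.SameCycle d d' ↔ d.fst = d'.fst

namespace RotationSystem

variable {V : Type*} {G : SimpleGraph V}

/-- The permutation that walks along the faces: after traversing the dart `d` from `d.fst` to
`d.snd`, continue with the dart leaving `d.snd` that follows the reversal of `d` in the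
rotation at `d.snd`. -/
def facePerm (R : RotationSystem G) : Equiv.Perm G.Dart :=
  (Function.Involutive.toPerm SimpleGraph.Dart.symm SimpleGraph.Dart.symm_involutive).trans R.next

/-- The faces of a combinatorial embedding: the orbits of the face permutation. -/
def Face (R : RotationSystem G) : Type _ :=
  Quotient (Equiv.Perm.SameCycle.setoid R.facePerm)

/-- The face on whose boundary walk the dart `d` lies. -/
def faceOf (R : RotationSystem G) (d : G.Dart) : R.Face :=
  Quotient.mk (Equiv.Perm.SameCycle.setoid R.facePerm) d

/-- The darts of the boundary walk of a face. -/
def faceDarts (R : RotationSystem G) (f : R.Face) : Set G.Dart :=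
  {d | R.faceOf d = f}

/-- A vertex lies on the boundary of the face `f`. -/
def OnBoundary (R : RotationSystem G) (f : R.Face) (v : V) : Prop :=
  ∃ d ∈ R.faceDarts f, d.fst = v

/-- The edges of the boundary of the face `f`. -/
def boundaryEdges (R : RotationSystem G) (f : R.Face) : Set (Sym2 V) :=
  SimpleGraph.Dart.edge '' R.faceDarts f

/-- The embedding is an embedding in the sphere: the (finite) graph is connected and Euler's
formula `|V| - |E| + |F| = 2` holds. (Every graph to which this is applied has an edge, so that
each face has a dart on its boundary.) Together with the choice of an outer face this is a
connected plane graph. -/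
structure IsPlane (R : RotationSystem G) : Prop where
  connected : G.Connected
  euler : Nat.card V + Nat.card R.Face = Nat.card G.edgeSet + 2

/-- A near-triangulation with outer face `outer`: a connected plane graph whose outer face is
bounded by a cycle (the boundary walk has length at least three and repeats no vertex) and all
of whose other faces are triangles. -/
structure IsNearTriangulation (R : RotationSystem G) (outer : R.Face) : Prop where
  isPlane : R.IsPlane
  outer_injOn : Set.InjOn (fun d : G.Dart => d.fst) (R.faceDarts outer)
  three_le_outer : 3 ≤ (R.faceDarts outer).ncard
  inner_triangle : ∀ f : R.Face, f ≠ outer → (R.faceDarts f).ncard = 3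

end RotationSystem

open Classical in
/-- The decorated graph polynomial `∏ (a_e x_i + b_e x_j)`, over the edges `e = x_i x_j` of `G`
with `i < j`; so `x_i` is the smaller end `e.inf` and `x_j` the larger end `e.sup`. -/
noncomputable def decoratedPoly {V : Type*} [Fintype V] [LinearOrder V] {F : Type*} [Field F]
    (G : SimpleGraph V) (a b : Sym2 V → F) : MvPolynomial V F :=
  ∏ e ∈ G.edgeFinset,
    (MvPolynomial.C (a e) * MvPolynomial.X e.inf + MvPolynomial.C (b e) * MvPolynomial.X e.sup)

/-!
The proof follows the pattern of Thomassen's proof that planar graphs are 5-choosable, with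
monomials in place of colourings.

A near-triangulation is replaced by its set of oriented inner triangles `T a b c`
(`RotationSystem.triangles`). What is needed of planarity is that this is a triangulated disk,
`TriDisk`: vertex links are connected, the graph is connected, and the first homology modulo two
relative to the boundary vanishes. The last property follows from Euler's formula by a dimension
count (`RotationSystem.IsNearTriangulation.triDisk`): the incidence matrix of inner vertices and
inner edges has full row rank, that of inner edges and inner faces has a kernel of dimension at
most one, their product is zero, and the numbers of inner vertices, edges and faces satisfy
`V - E + F = 1`. The class of triangulated disks is closed under the two operations of the
induction, and its properties are inherited directly, without further use of Euler's formula.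

The induction (`TriDisk.exists_isGood`) is on the number of triangles. Let `v` be the neighbour
on the boundary of `x` other than `y`, and `w` the other boundary neighbour of `v`.

* If `v` has a chord, then the chord with its ends on the boundary is a relative cycle, so it
  bounds, and this splits the disk into two disks that share only the chord
  (`TriDisk.side_triDisk`). The monomial of the side with `xy`, times that of the other side with
  the chord as its distinguished edge, works: the second does not contain the ends of the chord,
  so the product arises in only one way (`TriDisk.IsCut.isGood_add`).
* Otherwise deleting `v` leaves a disk (`TriDisk.del_triDisk`), or the disk is a single triangle.
  Let `m` be a monomial of the smaller disk, and `P` the product of the inner neighbours of `v`,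
  which have degree at most two in `m`. As `x` must not occur, the edge `vx` contributes `v`.
  If `w = y` then `m P v ^ 2` occurs, and if `w` has degree at most one in `m` then `m P w v`
  occurs, both without cancellation. If `w` has degree two and `m P v ^ 2` does not occur, then
  the contribution of `m` is cancelled by contributions of monomials `m p / w`, where `p` is an
  inner neighbour of `v`. So some `m p / w` occurs in the polynomial of the smaller disk; as `w`
  has degree one in it, `(m p / w) P w v` occurs (`TriDisk.exists_star_of_le_two`).
-/

namespace TriDisk

variable {V : Type*}

/-- The dart from `a` to `b` has a triangle of `T` on its left. -/
def HasTri (T : V → V → V → Prop) (a b : V) : Prop := ∃ c, T a b c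

/-- Adjacency in the graph formed by the edges of the triangles. -/
def Adj (T : V → V → V → Prop) (a b : V) : Prop := HasTri T a b ∨ HasTri T b a

/-- The edge `ab` has a triangle on both sides. -/
def Inner (T : V → V → V → Prop) (a b : V) : Prop := HasTri T a b ∧ HasTri T b a

/-- The edge `ab` is a boundary edge, and the triangle incident with it is on the left of the
dart from `a` to `b`. -/
def Bd (T : V → V → V → Prop) (a b : V) : Prop := HasTri T a b ∧ ¬ HasTri T b a

/-- The vertices incident with a boundary edge. -/
def BdVertex (T : V → V → V → Prop) (w : V) : Prop := ∃ b, Bd T w b ∨ Bd T b w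

/-- The vertices of the triangles. -/
def IsVertex (T : V → V → V → Prop) (w : V) : Prop := ∃ b, Adj T w b

end TriDisk

open TriDisk in
/-- A connected triangulated surface with boundary, given by its positively oriented triangles:
`T a b c` says that `abc` is a triangle, in this cyclic order. Connectedness (of the link of each
vertex in `link`, of the whole graph in `conn`) is expressed by the absence of non-constant
locally constant predicates. -/
structure TriSurface {V : Type*} (T : V → V → V → Prop) : Prop where
  cyc : ∀ {a b c}, T a b c → T b c a
  uniq : ∀ {a b c c'}, T a b c → T a b c' → c = c'
  ne : ∀ {a b c}, T a b c → a ≠ b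
  link : ∀ (a : V) (f : V → Prop), (∀ b c, T a b c → (f b ↔ f c)) →
    ∀ p q, Adj T a p → Adj T a q → (f p ↔ f q)
  conn : ∀ f : V → Prop, (∀ a b, Adj T a b → (f a ↔ f b)) →
    ∀ p q, IsVertex T p → IsVertex T q → (f p ↔ f q)

open TriDisk in
/-- A triangulated disk: a triangulated surface whose first homology modulo two relative to the
boundary vanishes. A relative cycle `z` is a set of inner edges that has even degree at every
inner vertex, and `τ` is the set of triangles that it bounds, given as a function of the darts
on the boundary of the triangles. The existence of a boundary edge is not demanded, so that
spheres are included; a boundary edge is a hypothesis where it matters. -/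
structure TriDisk {V : Type*} [Fintype V] (T : V → V → V → Prop) : Prop extends
    TriSurface T where
  relHom : ∀ z : V → V → ZMod 2, (∀ a b, z a b = z b a) → (∀ a b, z a b ≠ 0 → Inner T a b) →
    (∀ w, ¬ BdVertex T w → ∑ b, z w b = 0) →
    ∃ τ : V → V → ZMod 2, (∀ a b c, T a b c → τ a b = τ b c) ∧
      ∀ a b, Inner T a b → z a b = τ a b + τ b a

namespace TriDisk

/-! ### Links and boundary darts -/

section basic

variable {V : Type*} {T : V → V → V → Prop}

theorem Adj.symm {a b : V} (h : Adj T a b) : Adj T b a := Or.symm h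

theorem Inner.symm {a b : V} (h : Inner T a b) : Inner T b a := And.symm h

theorem Inner.adj {a b : V} (h : Inner T a b) : Adj T a b := Or.inl h.1

theorem Bd.adj {a b : V} (h : Bd T a b) : Adj T a b := Or.inl h.1

theorem Bd.left {a b : V} (h : Bd T a b) : BdVertex T a := ⟨b, Or.inl h⟩

theorem Bd.right {a b : V} (h : Bd T a b) : BdVertex T b := ⟨a, Or.inr h⟩

theorem Adj.cases {a b : V} (h : Adj T a b) : Inner T a b ∨ Bd T a b ∨ Bd T b a := by
  unfold Adj Inner Bd at *; tauto

theorem adj₁₂ {a b c : V} (h : T a b c) : Adj T a b := Or.inl ⟨c, h⟩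

/-- A function of the triangles that does not change along the inner edges at a vertex is
constant around this vertex. -/
theorem _root_.TriSurface.face_eq (hT : TriSurface T) {a : V} {τ : V → V → ZMod 2}
    (hτ : ∀ {b c d}, T b c d → τ b c = τ c d) (hs : ∀ {q}, Inner T a q → τ a q = τ q a)
    {p q : V} (hp : HasTri T a p) (hq : HasTri T a q) : τ a p = τ a q := by
  have key := hT.link a
      (fun r => (HasTri T a r → τ a r = τ a p) ∧ (HasTri T r a → τ r a = τ a p)) (by
    intro b c hbc
    have h1 : τ c a = τ a b := hτ (hT.cyc (hT.cyc hbc))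
    have hb : HasTri T a b := ⟨c, hbc⟩
    have hc : HasTri T c a := ⟨b, hT.cyc (hT.cyc hbc)⟩
    constructor
    · rintro ⟨h2, -⟩
      have h3 : τ c a = τ a p := h1.trans (h2 hb)
      exact ⟨fun h4 => (hs ⟨h4, hc⟩).trans h3, fun _ => h3⟩
    · rintro ⟨-, h2⟩
      have h3 : τ a b = τ a p := h1.symm.trans (h2 hc)
      exact ⟨fun _ => h3, fun h4 => (hs ⟨hb, h4⟩).symm.trans h3⟩) p q (Or.inl hp) (Or.inl hq)
  exact ((key.1 ⟨fun _ => rfl, fun h => (hs ⟨hp, h⟩).symm⟩).1 hq).symm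

variable [Fintype V] (hT : TriDisk T)
include hT

theorem adj_ne {a b : V} (h : Adj T a b) : a ≠ b := by
  rcases h with ⟨c, h⟩ | ⟨c, h⟩
  · exact hT.ne h
  · exact (hT.ne h).symm

theorem adj₁₃ {a b c : V} (h : T a b c) : Adj T a c := Or.inr ⟨b, hT.cyc (hT.cyc h)⟩

theorem uniq_mid {a b b' c : V} (h : T a b c) (h' : T a b' c) : b = b' :=
  hT.uniq (hT.cyc (hT.cyc h)) (hT.cyc (hT.cyc h'))

theorem bd_succ_unique {a b b' : V} (h : Bd T a b) (h' : Bd T a b') : b = b' := by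
  have key : Relation.ReflTransGen (T a) b b ↔ Relation.ReflTransGen (T a) b b' := by
    refine hT.link a (fun q => Relation.ReflTransGen (T a) b q) ?_ _ _ h.adj h'.adj
    intro p q hpq
    refine ⟨fun hp => hp.tail hpq, fun hq => ?_⟩
    rcases Relation.ReflTransGen.cases_tail hq with rfl | ⟨r, hr, hrq⟩
    · exact absurd ⟨p, hT.cyc (hT.cyc hpq)⟩ h.2
    · rwa [hT.uniq_mid hpq hrq]
  rcases Relation.ReflTransGen.cases_tail (key.1 .refl) with hb | ⟨r, -, hr⟩
  · exact hb.symm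
  · exact absurd ⟨r, hT.cyc (hT.cyc hr)⟩ h'.2

theorem bd_pred_unique {a b b' : V} (h : Bd T b a) (h' : Bd T b' a) : b = b' := by
  have key : Relation.ReflTransGen (T a) b b ↔ Relation.ReflTransGen (T a) b' b := by
    refine hT.link a (fun q => Relation.ReflTransGen (T a) q b) ?_ _ _ h.adj.symm h'.adj.symm
    intro p q hpq
    refine ⟨fun hp => ?_, fun hq => hq.head hpq⟩
    rcases Relation.ReflTransGen.cases_head hp with rfl | ⟨r, hr, hrq⟩
    · exact absurd ⟨q, hpq⟩ h.2
    · rwa [hT.uniq hpq hr]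
  rcases Relation.ReflTransGen.cases_head (key.1 .refl) with hb | ⟨r, hr, -⟩
  · exact hb.symm
  · exact absurd ⟨r, hr⟩ h'.2

open Classical in
theorem sum_tri_fst {M : Type*} [AddCommMonoid M] (a : V) (f : V → M) :
    ∑ b, ∑ c, (if T a b c then f b else 0) = ∑ b, if HasTri T a b then f b else 0 := by
  refine Finset.sum_congr rfl fun b _ => ?_
  split_ifs with h
  · obtain ⟨c, hc⟩ := h
    rw [Finset.sum_eq_single c, if_pos hc]
    · exact fun c' _ hne => if_neg fun hc' => hne (hT.uniq hc' hc)
    · simp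
  · exact Finset.sum_eq_zero fun c _ => if_neg fun hc => h ⟨c, hc⟩

open Classical in
theorem sum_tri_snd {M : Type*} [AddCommMonoid M] (a : V) (f : V → M) :
    ∑ b, ∑ c, (if T a b c then f c else 0) = ∑ c, if HasTri T c a then f c else 0 := by
  rw [Finset.sum_comm]
  refine Finset.sum_congr rfl fun c _ => ?_
  split_ifs with h
  · obtain ⟨b, hb⟩ := h
    rw [Finset.sum_eq_single b, if_pos (hT.cyc hb)]
    · exact fun b' _ hne => if_neg fun hb' => hne (hT.uniq (hT.cyc (hT.cyc hb')) hb)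
    · simp
  · exact Finset.sum_eq_zero fun b _ => if_neg fun hb => h ⟨b, hT.cyc (hT.cyc hb)⟩

open Classical in
/-- The link of `x` has as many first as last ends of edges. -/
theorem card_hasTri (x : V) : (Finset.univ.filter fun b => HasTri T x b).card =
    (Finset.univ.filter fun c => HasTri T c x).card := by
  have h := hT.sum_tri_fst x (fun _ => 1)
  rw [hT.sum_tri_snd x (fun _ => 1)] at h
  rw [Finset.card_filter, Finset.card_filter, h]

theorem exists_bd_pred {x y : V} (h : Bd T x y) : ∃ v, Bd T v x := by
  classical
  by_contra! hcon
  have heq := Finset.eq_of_subset_of_card_le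
    (Finset.monotone_filter_right Finset.univ fun c _ (hc : HasTri T c x) => by
      by_contra hne; exact hcon c ⟨hc, hne⟩) (hT.card_hasTri x).le
  have hy : y ∈ Finset.univ.filter (fun b => HasTri T x b) := by simpa using h.1
  rw [← heq] at hy
  exact h.2 (by simpa using hy)

theorem exists_bd_succ {x y : V} (h : Bd T y x) : ∃ v, Bd T x v := by
  classical
  by_contra! hcon
  have heq := Finset.eq_of_subset_of_card_le
    (Finset.monotone_filter_right Finset.univ fun c _ (hc : HasTri T x c) => by
      by_contra hne; exact hcon c ⟨hc, hne⟩) (hT.card_hasTri x).ge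
  have hy : y ∈ Finset.univ.filter (fun b => HasTri T b x) := by simpa using h.1
  rw [← heq] at hy
  exact h.2 (by simpa using hy)

/-- A predicate on the cyclic link of an inner vertex cannot change its value on exactly one
edge of the link. -/
theorem link_cycle {a : V} (ha : ¬ BdVertex T a) {f : V → Prop} {b₀ c₀ : V} (h₀ : T a b₀ c₀)
    (hf : ∀ b c, T a b c → b ≠ b₀ → (f b ↔ f c)) : f b₀ ↔ f c₀ := by
  classical
  have hiff : ∀ b, HasTri T a b ↔ HasTri T b a := fun b => by
    unfold BdVertex Bd at ha; push Not at ha; exact ⟨(ha b).1, (ha b).2⟩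
  set g : V → ℤ := fun q => if f q then 1 else 0 with hg
  have h1 := hT.sum_tri_fst a g
  have h2 := hT.sum_tri_snd a g
  simp only [hiff] at h1
  rw [← h2, ← sub_eq_zero, ← Finset.sum_sub_distrib] at h1
  simp only [← Finset.sum_sub_distrib] at h1
  rw [Finset.sum_eq_single b₀, Finset.sum_eq_single c₀, if_pos h₀, if_pos h₀] at h1
  · simp only [hg] at h1
    by_cases hb : f b₀ <;> by_cases hc : f c₀ <;> simp_all
  · intro c _ hne
    rw [if_neg fun hc => hne (hT.uniq hc h₀), if_neg fun hc => hne (hT.uniq hc h₀), sub_zero]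
  · simp
  · intro b _ hne
    refine Finset.sum_eq_zero fun c _ => ?_
    split_ifs with hbc
    · have := hf b c hbc hne
      simp [hg, this]
    · simp
  · simp

end basic

/-! ### Cutting a triangulated disk along a chord -/

section chord

variable {V : Type*} {T : V → V → V → Prop}

/-- The triangles on which the face function `τ` takes the value `i`. -/
def side (T : V → V → V → Prop) (τ : V → V → ZMod 2) (i : ZMod 2) (a b c : V) : Prop :=
  T a b c ∧ τ a b = i

theorem hasTri_side {τ : V → V → ZMod 2} {i : ZMod 2} {a b : V} :
    HasTri (side T τ i) a b ↔ HasTri T a b ∧ τ a b = i := by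
  simp [HasTri, side]

theorem Adj.of_side {τ : V → V → ZMod 2} {i : ZMod 2} {a b : V} (h : Adj (side T τ i) a b) :
    Adj T a b := by
  simp only [Adj, hasTri_side] at h ⊢; tauto

/-- `τ` is a face function that jumps along the inner edge `up`, whose ends are on the
boundary, and along no other inner edge. -/
structure IsCut (T : V → V → V → Prop) (u p : V) (τ : V → V → ZMod 2) : Prop where
  inner : Inner T u p
  left : BdVertex T u
  right : BdVertex T p
  face : ∀ {a b c}, T a b c → τ a b = τ b c
  same : ∀ {a b}, Inner T a b → s(a, b) ≠ s(u, p) → τ a b = τ b a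
  jump : τ u p ≠ τ p u

theorem IsCut.adj_side {u p : V} {τ : V → V → ZMod 2} (h : IsCut T u p τ) (i : ZMod 2) :
    Adj (side T τ i) u p := by
  have h1 := h.inner
  have h2 : τ u p = i ∨ τ p u = i := by
    have := h.jump
    generalize τ u p = m at *
    generalize τ p u = n at *
    revert m n i; decide
  rcases h2 with h2 | h2
  · exact Or.inl (hasTri_side.2 ⟨h1.1, h2⟩)
  · exact Or.inr (hasTri_side.2 ⟨h1.2, h2⟩)

theorem IsCut.bd_side {u p : V} {τ : V → V → ZMod 2} (h : IsCut T u p τ) :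
    Bd (side T τ (τ u p)) u p := by
  simp only [Bd, hasTri_side, h.inner.1, h.inner.2, true_and]
  exact h.jump.symm

theorem IsCut.symm {u p : V} {τ : V → V → ZMod 2} (h : IsCut T u p τ) : IsCut T p u τ where
  inner := h.inner.symm
  left := h.right
  right := h.left
  face := h.face
  same := fun h1 h2 => h.same h1 (by rwa [Sym2.eq_swap (a := u)])
  jump := h.jump.symm

theorem inner_of_side {τ : V → V → ZMod 2} {i : ZMod 2} {a b : V}
    (h : Inner (side T τ i) a b) : Inner T a b :=
  ⟨(hasTri_side.1 h.1).1, (hasTri_side.1 h.2).1⟩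

theorem bd_side_of_bd {τ : V → V → ZMod 2} {i : ZMod 2} {a b : V} (h : Bd T a b) (hi : τ a b = i) :
    Bd (side T τ i) a b := by
  refine ⟨hasTri_side.2 ⟨h.1, hi⟩, fun h' => h.2 (hasTri_side.1 h').1⟩

/-- The two sides of a chord share no edge besides the chord. -/
theorem IsCut.eq_of_adj_side {u p : V} {τ : V → V → ZMod 2} (hc : IsCut T u p τ)
    {i j : ZMod 2} (hij : i ≠ j) {a b : V} (hi : Adj (side T τ i) a b)
    (hj : Adj (side T τ j) a b) : s(a, b) = s(u, p) := by
  by_contra h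
  have h1 := hc.same (a := a) (b := b)
  simp only [Adj, hasTri_side] at hi hj
  rcases hi with ⟨hi, rfl⟩ | ⟨hi, rfl⟩ <;> rcases hj with ⟨hj, rfl⟩ | ⟨hj, rfl⟩
  · exact hij rfl
  · exact hij (h1 ⟨hi, hj⟩ h)
  · exact hij (h1 ⟨hj, hi⟩ h).symm
  · exact hij rfl

theorem IsCut.bd_of_bd_side {u p : V} {τ : V → V → ZMod 2} (hc : IsCut T u p τ)
    {i : ZMod 2} {a b : V} (h : Bd (side T τ i) a b) :
    Bd T a b ∨ s(a, b) = s(u, p) := by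
  by_contra! hcon
  obtain ⟨h1, h2⟩ := h
  rw [hasTri_side] at h1 h2
  have h3 : HasTri T b a := by by_contra h; exact hcon.1 ⟨h1.1, h⟩
  exact h2 ⟨h3, (hc.same ⟨h1.1, h3⟩ hcon.2).symm.trans h1.2⟩

theorem IsCut.bdVertex_of_side {u p : V} {τ : V → V → ZMod 2} (hc : IsCut T u p τ)
    {i : ZMod 2} {a : V} (h : BdVertex (side T τ i) a) : BdVertex T a := by
  obtain ⟨b, h⟩ := h
  have : Bd T a b ∨ Bd T b a ∨ a = u ∨ a = p := by
    rcases h with h | h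
    · rcases hc.bd_of_bd_side h with h | h
      · exact Or.inl h
      · rw [Sym2.eq_iff] at h; tauto
    · rcases hc.bd_of_bd_side h with h | h
      · exact Or.inr (Or.inl h)
      · rw [Sym2.eq_iff] at h; tauto
  rcases this with h | h | rfl | rfl
  exacts [h.left, h.right, hc.left, hc.right]

variable [Fintype V] (hT : TriDisk T)
include hT

/-- Vanishing relative homology separates the two sides of a chord. -/
theorem exists_isCut {u p : V} (hi : Inner T u p) (hu : BdVertex T u) (hp : BdVertex T p) :
    ∃ τ, IsCut T u p τ := by
  classical
  obtain ⟨τ, hτ, hz⟩ := hT.relHom (fun a b => if s(a, b) = s(u, p) then 1 else 0)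
    (fun a b => by rw [Sym2.eq_swap]) (fun a b hab => by
      have hab : s(a, b) = s(u, p) := by by_contra h; simp [h] at hab
      rcases Sym2.eq_iff.1 hab with ⟨rfl, rfl⟩ | ⟨rfl, rfl⟩
      exacts [hi, hi.symm]) (fun w hw => by
      refine Finset.sum_eq_zero fun b _ => if_neg fun hb => hw ?_
      rcases Sym2.eq_iff.1 hb with ⟨rfl, rfl⟩ | ⟨rfl, rfl⟩
      exacts [hu, hp])
  refine ⟨τ, hi, hu, hp, fun h => hτ _ _ _ h, fun h hne => ?_, fun h => ?_⟩
  · have := hz _ _ h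
    rw [if_neg hne] at this
    exact CharTwo.add_eq_zero.1 this.symm
  · have := hz _ _ hi
    rw [if_pos rfl, h, CharTwo.add_self_eq_zero] at this
    exact one_ne_zero this

variable {u p : V} {τ : V → V → ZMod 2} (hc : IsCut T u p τ)
include hc

/-- Away from the ends of the chord, all triangles around a vertex are on the same side. -/
theorem side_of_isVertex {i : ZMod 2} {a b : V} (ha : IsVertex (side T τ i) a) (hu : a ≠ u)
    (hp : a ≠ p) (hb : HasTri T a b) : τ a b = i := by
  obtain ⟨q, hq⟩ := ha
  obtain ⟨c, hc', hτ⟩ : ∃ c, HasTri T a c ∧ τ a c = i := by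
    rcases hq with ⟨c, h⟩ | ⟨c, h⟩
    · exact ⟨q, ⟨c, h.1⟩, h.2⟩
    · exact ⟨c, ⟨q, hT.cyc h.1⟩, (hc.face h.1).symm.trans h.2⟩
  rw [← hτ]
  exact hT.face_eq hc.face (fun h => hc.same h (by simp [hu, hp])) hb hc'

/-- The two sides of a chord share only the ends of the chord. -/
theorem eq_of_isVertex_side {i j : ZMod 2} (hij : i ≠ j) {a : V} (hi : IsVertex (side T τ i) a)
    (hj : IsVertex (side T τ j) a) : a = u ∨ a = p := by
  by_contra! h
  obtain ⟨q, hq⟩ := id hi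
  have : ∃ b, HasTri T a b := by
    rcases hq with ⟨c, h, -⟩ | ⟨c, h, -⟩
    · exact ⟨q, c, h⟩
    · exact ⟨c, q, hT.cyc h⟩
  obtain ⟨b, hb⟩ := this
  exact hij ((hT.side_of_isVertex hc hi h.1 h.2 hb).symm.trans
    (hT.side_of_isVertex hc hj h.1 h.2 hb))

theorem bdVertex_side {i : ZMod 2} {a : V} (h : BdVertex T a) (hi : IsVertex (side T τ i) a) :
    BdVertex (side T τ i) a := by
  have hup : ∀ i, BdVertex (side T τ i) u ∧ BdVertex (side T τ i) p := by
    intro i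
    have h2 : i = τ u p ∨ i = τ p u := by
      have := hc.jump
      generalize τ u p = m at *
      generalize τ p u = n at *
      revert m n i; decide
    rcases h2 with rfl | rfl
    · exact ⟨hc.bd_side.left, hc.bd_side.right⟩
    · exact ⟨hc.symm.bd_side.right, hc.symm.bd_side.left⟩
  by_cases hu : a = u
  · exact hu ▸ (hup i).1
  by_cases hp : a = p
  · exact hp ▸ (hup i).2
  obtain ⟨b, h | h⟩ := h
  · exact (bd_side_of_bd h (hT.side_of_isVertex hc hi hu hp h.1)).left
  · obtain ⟨c, hbc⟩ := id h.1
    refine (bd_side_of_bd h ?_).right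
    rw [hc.face hbc]
    exact hT.side_of_isVertex hc hi hu hp ⟨b, hT.cyc hbc⟩

/-- Each side of a chord is a triangulated disk: locally constant predicates on it extend to the
whole disk by a constant, and relative cycles by zero. -/
theorem side_triDisk (i : ZMod 2) : TriDisk (side T τ i) where
  cyc := fun h => ⟨hT.cyc h.1, (hc.face h.1).symm.trans h.2⟩
  uniq := fun h h' => hT.uniq h.1 h'.1
  ne := fun h => hT.ne h.1
  link := by
    classical
    intro a f hf q r hq hr
    have : ∃ q₀, ∀ b, Adj (side T τ i) a b → (∃ j ≠ i, Adj (side T τ j) a b) → b = q₀ := by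
      refine ⟨if a = u then p else u, fun b hb hb' => ?_⟩
      obtain ⟨j, hj, hb'⟩ := hb'
      rcases Sym2.eq_iff.1 (hc.eq_of_adj_side hj.symm hb hb') with ⟨rfl, rfl⟩ | ⟨rfl, rfl⟩
      · simp
      · exact (if_neg (hT.adj_ne hc.inner.adj).symm).symm
    obtain ⟨q₀, hq₀⟩ := this
    have key := hT.link a (fun b => if Adj (side T τ i) a b then f b else f q₀) (by
      intro b c hbc
      have hτ : τ c a = τ a b := hc.face (hT.cyc (hT.cyc hbc))
      have hb : Adj (side T τ (τ a b)) a b := Or.inl ⟨c, hbc, rfl⟩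
      have hc : Adj (side T τ (τ a b)) a c := Or.inr ⟨b, hT.cyc (hT.cyc hbc), hτ⟩
      by_cases hi : τ a b = i
      · rw [hi] at hb hc
        rw [if_pos hb, if_pos hc]
        exact hf b c ⟨hbc, hi⟩
      · have : ∀ d, Adj (side T τ (τ a b)) a d →
            ((if Adj (side T τ i) a d then f d else f q₀) ↔ f q₀) := by
          intro d hd
          split_ifs with h
          · rw [hq₀ d h ⟨_, hi, hd⟩]
          · rfl
        exact (this b hb).trans (this c hc).symm) q r hq.of_side hr.of_side
    simpa only [if_pos hq, if_pos hr] using key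
  conn := by
    classical
    intro f hf q r hq hr
    have key := hT.conn (fun a => if IsVertex (side T τ i) a then f a else f u) (by
      have main : ∀ a b, HasTri T a b → ((if IsVertex (side T τ i) a then f a else f u) ↔
          (if IsVertex (side T τ i) b then f b else f u)) := by
        intro a b hab
        have hab : Adj (side T τ (τ a b)) a b := Or.inl (hasTri_side.2 ⟨hab, rfl⟩)
        by_cases hi : τ a b = i
        · rw [hi] at hab
          rw [if_pos ⟨b, hab⟩, if_pos ⟨a, hab.symm⟩]
          exact hf a b hab
        · have : ∀ d, IsVertex (side T τ (τ a b)) d →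
              ((if IsVertex (side T τ i) d then f d else f u) ↔ f u) := by
            intro d hd
            split_ifs with h
            · rcases hT.eq_of_isVertex_side hc hi hd h with rfl | rfl
              · rfl
              · exact (hf _ _ (hc.adj_side i)).symm
            · rfl
          exact (this a ⟨b, hab⟩).trans (this b ⟨a, hab.symm⟩).symm
      rintro a b (h | h)
      · exact main a b h
      · exact (main b a h).symm) q r (hq.imp fun _ h => h.of_side) (hr.imp fun _ h => h.of_side)
    simpa only [if_pos hq, if_pos hr] using key
  relHom := by
    classical
    intro z hz hs hw
    obtain ⟨τ', h1, h2⟩ := hT.relHom z hz (fun a b h => inner_of_side (hs a b h))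
      (fun w h => hw w fun h' => h (hc.bdVertex_of_side h'))
    exact ⟨τ', fun a b c h => h1 a b c h.1, fun a b h => h2 a b (inner_of_side h)⟩

end chord

/-! ### Deleting a boundary vertex that is in no chord -/

section delete

variable {V : Type*} {T : V → V → V → Prop}

/-- The triangles that avoid the vertex `v`. -/
def del (T : V → V → V → Prop) (v a b c : V) : Prop :=
  T a b c ∧ a ≠ v ∧ b ≠ v ∧ c ≠ v

theorem HasTri.of_del {v a b : V} (h : HasTri (del T v) a b) : HasTri T a b :=
  h.imp fun _ h => h.1

theorem Adj.of_del {v a b : V} (h : Adj (del T v) a b) : Adj T a b :=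
  h.imp HasTri.of_del HasTri.of_del

theorem Adj.ne_of_del {v a b : V} (h : Adj (del T v) a b) : a ≠ v ∧ b ≠ v := by
  rcases h with ⟨c, h⟩ | ⟨c, h⟩
  exacts [⟨h.2.1, h.2.2.1⟩, ⟨h.2.2.1, h.2.1⟩]

theorem Inner.of_del {v a b : V} (h : Inner (del T v) a b) : Inner T a b :=
  ⟨h.1.of_del, h.2.of_del⟩

/-- `v` is a boundary vertex without chords, its neighbours on the boundary walk are `w` before
it and `x` after it, and all edges that avoid `v` are in a triangle that avoids `v`. -/
structure IsEar (T : V → V → V → Prop) (w v x : V) : Prop where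
  pred : Bd T w v
  succ : Bd T v x
  chordless : ∀ {p}, Inner T v p → ¬ BdVertex T p
  keep : ∀ {a b}, Adj T a b → a ≠ v → b ≠ v → Adj (del T v) a b

theorem IsEar.ne {w v x : V} (hE : IsEar T w v x) : w ≠ x := by
  rintro rfl
  exact hE.pred.2 hE.succ.1

theorem IsEar.bd_del {w v x : V} (hE : IsEar T w v x) {a b : V} (h : Bd T a b)
    (ha : a ≠ v) (hb : b ≠ v) : Bd (del T v) a b := by
  have h1 := hE.keep h.adj ha hb
  have h2 : ¬ HasTri (del T v) b a := fun h' => h.2 h'.of_del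
  exact ⟨h1.resolve_right h2, h2⟩

variable [Fintype V] (hT : TriDisk T)
include hT

theorem eq_or_eq_of_adj_of_bdVertex {w v x a : V} (hw : Bd T w v) (hx : Bd T v x)
    (hch : ∀ p, Inner T v p → ¬ BdVertex T p) (ha : Adj T v a) (hb : BdVertex T a) :
    a = w ∨ a = x := by
  rcases ha.cases with h | h | h
  · exact absurd hb (hch a h)
  · exact Or.inr (hT.bd_succ_unique h hx)
  · exact Or.inl (hT.bd_pred_unique h hw)

/-- The only way in which an edge can be lost when a vertex without chords is deleted is that
its neighbours are adjacent on the boundary. -/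
theorem isEar_or {w v x : V} (hw : Bd T w v) (hx : Bd T v x)
    (hch : ∀ p, Inner T v p → ¬ BdVertex T p) : IsEar T w v x ∨ T v x w ∧ Bd T x w := by
  by_contra! hcon
  refine hcon.1 ⟨hw, hx, fun h => hch _ h, ?_⟩
  have main : ∀ a b, HasTri T a b → a ≠ v → b ≠ v → Adj (del T v) a b := by
    rintro a b ⟨c, hc⟩ ha hb
    by_cases hcv : c = v
    swap
    · exact Or.inl ⟨c, hc, ha, hb, hcv⟩
    subst hcv
    by_cases hba : HasTri T b a
    · obtain ⟨d, hd⟩ := hba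
      by_cases hdv : d = c
      swap
      · exact Or.inr ⟨d, hd, hb, ha, hdv⟩
      subst hdv
      -- the two triangles on `ab` would fill the whole link of the vertex
      exfalso
      have h1 := hT.cyc (hT.cyc hc)
      have h2 := hT.cyc (hT.cyc hd)
      have key := hT.link d (fun q => q = a ∨ q = b) (by
        intro p q hpq
        constructor
        · rintro (rfl | rfl)
          · exact Or.inr (hT.uniq hpq h1)
          · exact Or.inl (hT.uniq hpq h2)
        · rintro (rfl | rfl)
          · exact Or.inr (hT.uniq_mid hpq h2)
          · exact Or.inl (hT.uniq_mid hpq h1)) a x (Or.inl ⟨b, h1⟩) hx.adj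
      rcases key.1 (Or.inl rfl) with rfl | rfl
      · exact hx.2 ⟨b, hT.cyc (hT.cyc h2)⟩
      · exact hx.2 ⟨a, hT.cyc (hT.cyc h1)⟩
    · exfalso
      have hB : Bd T a b := ⟨⟨c, hc⟩, hba⟩
      have h1 := hT.cyc (hT.cyc hc)
      rcases hT.eq_or_eq_of_adj_of_bdVertex hw hx hch (adj₁₂ h1) hB.left with rfl | rfl
      · exact hw.2 ⟨b, h1⟩
      rcases hT.eq_or_eq_of_adj_of_bdVertex hw hx hch (hT.adj₁₃ h1) hB.right with rfl | rfl
      · exact hcon.2 h1 hB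
      · exact hT.ne hc rfl
  rintro a b (h | h) ha hb
  · exact main a b h ha hb
  · exact (main b a h hb ha).symm

/-- If the triangle `abc` is bounded by boundary edges then it is the whole disk. -/
theorem adj_of_triangle {a b c : V} (h₁ : Bd T a b) (h₂ : Bd T b c) (h₃ : Bd T c a)
    (h : T a b c) {p q : V} (hpq : Adj T p q) :
    s(p, q) = s(a, b) ∨ s(p, q) = s(b, c) ∨ s(p, q) = s(c, a) := by
  have nb : ∀ {a b c}, Bd T a b → Bd T c a → T a b c → ∀ {q}, Adj T a q → q = b ∨ q = c := by
    intro a b c h₁ h₃ h q hq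
    refine (hT.link a (fun q => q = b ∨ q = c) ?_ b q h₁.adj hq).1 (Or.inl rfl)
    intro r s hrs
    constructor
    · rintro (rfl | rfl)
      · exact Or.inr (hT.uniq hrs h)
      · exact absurd ⟨s, hrs⟩ h₃.2
    · rintro (rfl | rfl)
      · exact absurd ⟨r, hT.cyc (hT.cyc hrs)⟩ h₁.2
      · exact Or.inl (hT.uniq_mid hrs h)
  have na := fun q => nb h₁ h₃ h (q := q)
  have nb' := fun q => nb h₂ h₁ (hT.cyc h) (q := q)
  have nc := fun q => nb h₃ h₂ (hT.cyc (hT.cyc h)) (q := q)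
  have hp : p = a ∨ p = b ∨ p = c := by
    refine (hT.conn (fun p => p = a ∨ p = b ∨ p = c) ?_ a p ⟨b, h₁.adj⟩ ⟨q, hpq⟩).1 (Or.inl rfl)
    have : ∀ r s, Adj T r s → (r = a ∨ r = b ∨ r = c) → (s = a ∨ s = b ∨ s = c) := by
      rintro r s hrs (rfl | rfl | rfl)
      · have := na s hrs; tauto
      · have := nb' s hrs; tauto
      · have := nc s hrs; tauto
    exact fun r s hrs => ⟨this r s hrs, this s r hrs.symm⟩
  simp only [Sym2.eq_iff]
  rcases hp with rfl | rfl | rfl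
  · have := na q hpq; tauto
  · have := nb' q hpq; tauto
  · have := nc q hpq; tauto

variable {w v x : V} (hE : IsEar T w v x)
include hE

/-- All edges of the link of the deleted vertex are kept. -/
theorem IsEar.adj_link {a b : V} (h : T v a b) : Adj (del T v) a b :=
  hE.keep (Or.inl ⟨v, hT.cyc h⟩) (hT.ne h).symm (hT.ne (hT.cyc (hT.cyc h)))

/-- The boundary vertices stay on the boundary. -/
theorem IsEar.bdVertex_del {a : V} (h : BdVertex T a) (ha : a ≠ v) : BdVertex (del T v) a := by
  obtain ⟨b, h⟩ := h
  by_cases hb : b = v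
  · subst hb
    rcases h with h | h
    · obtain rfl := hT.bd_pred_unique h hE.pred
      obtain ⟨c, hc⟩ := hT.exists_bd_pred h
      refine (hE.bd_del hc ?_ ha).right
      rintro rfl
      exact h.2 hc.1
    · obtain rfl := hT.bd_succ_unique h hE.succ
      obtain ⟨c, hc⟩ := hT.exists_bd_succ h
      refine (hE.bd_del hc ha ?_).left
      rintro rfl
      exact h.2 hc.1
  · rcases h with h | h
    · exact (hE.bd_del h ha hb).left
    · exact (hE.bd_del h hb ha).right

/-- The inner neighbours of the deleted vertex become boundary vertices. -/
theorem IsEar.bdVertex_del_of_inner {a : V} (h : Inner T v a) : BdVertex (del T v) a := by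
  obtain ⟨q, hq⟩ := h.1
  have h1 : ¬ HasTri (del T v) a q := fun ⟨c, hc⟩ => hc.2.2.2 (hT.uniq hc.1 (hT.cyc hq))
  exact ⟨q, Or.inr ⟨(hE.adj_link hT hq).resolve_left h1, h1⟩⟩

/-- New boundary vertices are neighbours of the deleted vertex. -/
theorem IsEar.adj_of_bdVertex_del {a : V} (h : BdVertex (del T v) a) (h' : ¬ BdVertex T a) :
    Adj T v a := by
  obtain ⟨b, h⟩ := h
  rcases h with ⟨h1, h2⟩ | ⟨h1, h2⟩
  · have h3 : HasTri T b a := by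
      by_contra h3; exact h' (Bd.left ⟨h1.of_del, h3⟩)
    obtain ⟨c, hc⟩ := h3
    have hn := Adj.ne_of_del (Or.inl h1)
    have : c = v := by
      by_contra hcv; exact h2 ⟨c, hc, hn.2, hn.1, hcv⟩
    subst this
    exact (adj₁₂ (hT.cyc hc)).symm
  · have h3 : HasTri T a b := by
      by_contra h3; exact h' (Bd.right ⟨h1.of_del, h3⟩)
    obtain ⟨c, hc⟩ := h3
    have hn := Adj.ne_of_del (Or.inl h1)
    have : c = v := by
      by_contra hcv; exact h2 ⟨c, hc, hn.2, hn.1, hcv⟩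
    subst this
    exact adj₁₂ (hT.cyc (hT.cyc hc))

/-- Deleting an ear leaves a triangulated disk. A relative cycle of the smaller disk may have odd
degree at neighbours of `v`; adding the edges from `v` to these gives a relative cycle of the
whole disk, because `v` is on the boundary. -/
theorem del_triDisk : TriDisk (del T v) where
  cyc := fun h => ⟨hT.cyc h.1, h.2.2.1, h.2.2.2, h.2.1⟩
  uniq := fun h h' => hT.uniq h.1 h'.1
  ne := fun h => hT.ne h.1
  link := by
    classical
    intro a f hf p q hp hq
    have ⟨hav, hpv⟩ := hp.ne_of_del
    have ⟨_, hqv⟩ := hq.ne_of_del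
    have hf' : ∀ b c, T a b c → b ≠ v → c ≠ v → (f b ↔ f c) :=
      fun b c h hb hc => hf b c ⟨h, hav, hb, hc⟩
    -- it suffices to find a value at `v` that fits both neighbours of `v` in the link
    obtain ⟨P, hP₁, hP₂⟩ : ∃ P : Prop, (∀ b, T a b v → (f b ↔ P)) ∧ (∀ c, T a v c → (P ↔ f c)) := by
      by_cases hc : ∃ c, T a v c
      · obtain ⟨c, hc⟩ := hc
        have hcv : c ≠ v := (hT.ne (hT.cyc hc)).symm
        refine ⟨f c, fun b hb => ?_, fun c' hc' => by rw [hT.uniq hc hc']⟩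
        have hbv : b ≠ v := hT.ne (hT.cyc hb)
        have hin : Inner T v a := ⟨⟨b, hT.cyc (hT.cyc hb)⟩, ⟨c, hc⟩⟩
        have := hT.link_cycle (hE.chordless hin)
          (f := fun q => if q = v then f c else f q) hb (by
            intro r s hrs hr
            by_cases hrv : r = v
            · subst hrv
              obtain rfl := hT.uniq hrs hc
              simp [hcv]
            · have hsv : s ≠ v := by
                rintro rfl; exact hr (hT.uniq_mid hrs hb)
              simpa [hrv, hsv] using hf' r s hrs hrv hsv)
        simpa [hbv] using this
      · by_cases hb : ∃ b, T a b v
        · obtain ⟨b, hb⟩ := hb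
          exact ⟨f b, fun b' hb' => by rw [hT.uniq_mid hb hb'], fun c h => absurd ⟨c, h⟩ hc⟩
        · exact ⟨True, fun b h => absurd ⟨b, h⟩ hb, fun c h => absurd ⟨c, h⟩ hc⟩
    have := hT.link a (fun q => if q = v then P else f q) (by
      intro r s hrs
      have hne : r ≠ s := hT.ne (hT.cyc hrs)
      by_cases hr : r = v
      · subst hr
        simpa [hne.symm] using hP₂ s hrs
      by_cases hs : s = v
      · subst hs
        simpa [hne] using hP₁ r hrs
      simpa [hr, hs] using hf' r s hrs hr hs) p q hp.of_del hq.of_del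
    simpa [hpv, hqv] using this
  conn := by
    classical
    intro f hf p q hp hq
    have hpv := hp.choose_spec.ne_of_del.1
    have hqv := hq.choose_spec.ne_of_del.1
    have hlink : ∀ a, Adj T v a → (f x ↔ f a) := fun a ha =>
      hT.link v f (fun b c h => hf b c (hE.adj_link hT h)) x a hE.succ.adj ha
    have := hT.conn (fun a => if a = v then f x else f a) (by
      intro a b hab
      have hne := hT.adj_ne hab
      by_cases ha : a = v
      · subst ha
        simpa [hne.symm] using hlink b hab
      by_cases hb : b = v
      · subst hb
        simpa [hne] using (hlink a hab.symm).symm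
      simpa [ha, hb] using hf a b (hE.keep hab ha hb)) p q
      (hp.imp fun _ h => h.of_del) (hq.imp fun _ h => h.of_del)
    simpa [hpv, hqv] using this
  relHom := by
    classical
    intro z hz hs hw
    have hzv : ∀ a, z a v = 0 := fun a => by
      by_contra h; exact (Adj.ne_of_del (hs _ _ h).adj).2 rfl
    have hvz : ∀ a, z v a = 0 := fun a => by rw [hz, hzv]
    set k : V → ZMod 2 := fun p => if Inner T v p then ∑ b, z p b else 0 with hk
    have hkv : k v = 0 := if_neg fun h => hT.adj_ne h.adj rfl
    obtain ⟨τ, h1, h2⟩ := hT.relHom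
      (fun a b => z a b + (if a = v then k b else 0) + (if b = v then k a else 0))
      (fun a b => by rw [hz]; ring)
      (by
        intro a b hab
        by_cases ha : a = v
        · subst ha
          by_contra hI
          refine hab ?_
          have : k b = 0 := if_neg hI
          simp [hvz, hkv, this]
        by_cases hb : b = v
        · subst hb
          by_contra hI
          refine hab ?_
          have : k a = 0 := if_neg fun h => hI h.symm
          simp [hzv, this, ha]
        · refine (hs a b ?_).of_del
          simpa [ha, hb] using hab)
      (by
        intro p hp
        have hpv : p ≠ v := by rintro rfl; exact hp hE.succ.left
        simp only [hpv, if_false, add_zero]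
        rw [Finset.sum_add_distrib]
        simp only [Finset.sum_ite_eq', Finset.mem_univ, if_true]
        by_cases hI : Inner T v p
        · simp only [hk, if_pos hI, CharTwo.add_self_eq_zero]
        · simp only [hk, if_neg hI, add_zero]
          refine hw p fun hb => ?_
          rcases (hE.adj_of_bdVertex_del hT hb hp).cases with h | h | h
          exacts [hI h, hp h.right, hp h.left])
    refine ⟨τ, fun a b c h => h1 a b c h.1, fun a b h => ?_⟩
    have hn := Adj.ne_of_del h.adj
    simpa [hn.1, hn.2] using h2 a b h.of_del

end delete

end TriDisk

/-! ### Coefficients of products of linear forms -/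

open MvPolynomial in
/-- The factor of the decorated graph polynomial that belongs to the edge `e`. -/
noncomputable def edgeForm {V : Type*} [LinearOrder V] {F : Type*} [Field F] (a b : Sym2 V → F)
    (e : Sym2 V) : MvPolynomial V F :=
  C (a e) * X e.inf + C (b e) * X e.sup

namespace TriDisk

section algebra

open MvPolynomial Finsupp

variable {V : Type*} {F : Type*} [Field F]

theorem edgeForm_eq [LinearOrder V] {a b : Sym2 V → F} {p q : V}
    (h : a s(p, q) ≠ 0 ∧ b s(p, q) ≠ 0) :
    ∃ α β : F, α ≠ 0 ∧ β ≠ 0 ∧ edgeForm a b s(p, q) = C α * X p + C β * X q := by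
  rcases le_total p q with hpq | hpq
  · exact ⟨_, _, h.1, h.2, by simp [edgeForm, hpq]⟩
  · exact ⟨_, _, h.2, h.1, by simp [edgeForm, hpq, add_comm]⟩

theorem coeff_form_mul (α β : F) (p q : V) (R : MvPolynomial V F) (m : V →₀ ℕ) :
    coeff (m + single p 1) ((C α * X p + C β * X q) * R) =
      α * coeff m R + β * coeff (m + single p 1) (X q * R) := by
  rw [add_mul, coeff_add, mul_assoc, mul_assoc, coeff_C_mul, coeff_C_mul, add_comm m,
    coeff_X_mul]

theorem coeff_X_mul_eq_zero {q : V} {m : V →₀ ℕ} (h : m q = 0) (R : MvPolynomial V F) :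
    coeff m (X q * R) = 0 := by
  classical
  rw [coeff_X_mul', if_neg (by simpa using h)]

theorem coeff_form_mul_of_eq_zero (α β : F) {p q : V} (hpq : p ≠ q) (R : MvPolynomial V F)
    {m : V →₀ ℕ} (h : m q = 0) :
    coeff (m + single p 1) ((C α * X p + C β * X q) * R) = α * coeff m R := by
  rw [coeff_form_mul, coeff_X_mul_eq_zero (by simp [h, hpq]), mul_zero, add_zero]

variable {v : V} {N : Finset V} {ℓ : V → MvPolynomial V F}

theorem single_apply_of_notMem {N : Finset V} {v : V} (h : v ∉ N) :
    ∀ p ∈ N, (single p 1 : V →₀ ℕ) v = 0 :=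
  fun p hp => single_eq_of_ne (by rintro rfl; exact h hp)

/-- In a monomial without `v`, every linear form in `v` and `p` contributes `p`. -/
theorem coeff_star_zero (hv : v ∉ N)
    (hℓ : ∀ p ∈ N, ∃ α β : F, α ≠ 0 ∧ β ≠ 0 ∧ ℓ p = C α * X p + C β * X v)
    (Q : MvPolynomial V F) {m : V →₀ ℕ} (hm : m v = 0) :
    coeff (m + ∑ p ∈ N, single p 1) ((∏ p ∈ N, ℓ p) * Q) ≠ 0 ↔ coeff m Q ≠ 0 := by
  classical
  induction N using Finset.induction_on with
  | empty => simp
  | insert p N hp ih =>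
    have hv' : v ∉ N := fun h => hv (Finset.mem_insert_of_mem h)
    obtain ⟨α, β, hα, -, h⟩ := hℓ p (Finset.mem_insert_self p N)
    rw [Finset.sum_insert hp, Finset.prod_insert hp, h, mul_assoc, add_comm (single p 1),
      ← add_assoc, coeff_form_mul_of_eq_zero α β (by rintro rfl; simp at hv)]
    · rw [← ih hv' fun q hq => hℓ q (Finset.mem_insert_of_mem hq)]
      simp [hα]
    · simpa [hm] using single_apply_of_notMem hv'

/-- A monomial of degree one in `v` takes `v` from exactly one of the linear forms in `v`
and `p`. -/
theorem coeff_star_one (hv : v ∉ N)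
    (hℓ : ∀ p ∈ N, ∃ α β : F, α ≠ 0 ∧ β ≠ 0 ∧ ℓ p = C α * X p + C β * X v)
    {Q : MvPolynomial V F} (hQ : ∀ m : V →₀ ℕ, m v ≠ 0 → coeff m Q = 0)
    {m : V →₀ ℕ} (hm : m v = 0)
    (h : coeff (m + ∑ p ∈ N, single p 1 + single v 1) ((∏ p ∈ N, ℓ p) * Q) ≠ 0) :
    ∃ p ∈ N, coeff (m + single p 1) Q ≠ 0 := by
  classical
  induction N using Finset.induction_on with
  | empty => exact absurd (hQ (m + single v 1) (by simp)) (by simpa using h)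
  | insert p N hp ih =>
    have hv' : v ∉ N := fun h => hv (Finset.mem_insert_of_mem h)
    have hvp : v ≠ p := by rintro rfl; simp at hv
    have hℓ' := fun q hq => hℓ q (Finset.mem_insert_of_mem hq)
    obtain ⟨α, β, hα, -, hp'⟩ := hℓ p (Finset.mem_insert_self p N)
    rw [Finset.sum_insert hp, Finset.prod_insert hp, hp', mul_assoc,
      show m + (single p 1 + ∑ p ∈ N, single p 1) + single v 1 =
        m + ∑ p ∈ N, single p 1 + single v 1 + single p 1 by abel, coeff_form_mul] at h
    by_cases h1 : coeff (m + ∑ p ∈ N, single p 1 + single v 1) ((∏ p ∈ N, ℓ p) * Q) = 0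
    · rw [h1, mul_zero, zero_add,
        show m + ∑ p ∈ N, single p 1 + single v 1 + single p 1 =
          single v 1 + (m + single p 1 + ∑ p ∈ N, single p 1) by abel, coeff_X_mul] at h
      refine ⟨p, Finset.mem_insert_self p N, ?_⟩
      rw [← coeff_star_zero hv' hℓ' Q (by simp [hm, hvp])]
      exact right_ne_zero_of_mul h
    · obtain ⟨q, hq, hq'⟩ := ih hv' hℓ' h1
      exact ⟨q, Finset.mem_insert_of_mem hq, hq'⟩

section star

variable {x w : V} {α β γ δ : F} (hα : α ≠ 0) (hγ : γ ≠ 0) (hδ : δ ≠ 0)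
  (hvx : v ≠ x) (hwx : w ≠ x) (hvw : v ≠ w) (hv : v ∉ N) (hx : x ∉ N)
  (hℓ : ∀ p ∈ N, ∃ α β : F, α ≠ 0 ∧ β ≠ 0 ∧ ℓ p = C α * X p + C β * X v)
  {Q : MvPolynomial V F} {m : V →₀ ℕ} (hmv : m v = 0) (hmx : m x = 0)

include hα hδ hvx hwx hvw hv hx hℓ hmv hmx in
/-- If the monomial has degree one in `v` and zero in `x`, then `v` comes from the edge `vx`,
so that nothing cancels. -/
theorem coeff_star_ne_zero_of_one (hm : coeff m Q ≠ 0) :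
    coeff (m + ∑ p ∈ N, single p 1 + single w 1 + single v 1)
      ((C α * X v + C β * X x) * ((C γ * X v + C δ * X w) * ((∏ p ∈ N, ℓ p) * Q))) ≠ 0 := by
  rw [coeff_form_mul_of_eq_zero α β hvx, add_comm (C γ * X v),
    coeff_form_mul_of_eq_zero δ γ hvw.symm]
  · exact mul_ne_zero hα (mul_ne_zero hδ ((coeff_star_zero hv hℓ Q hmv).2 hm))
  · simpa [hmv] using single_apply_of_notMem hv
  · simpa [hmx, hwx] using single_apply_of_notMem hx

include hvx hx hmx in
theorem coeff_star_two_eq :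
    coeff (m + ∑ p ∈ N, single p 1 + single v 1 + single v 1)
      ((C α * X v + C β * X x) * ((C γ * X v + C δ * X w) * ((∏ p ∈ N, ℓ p) * Q))) =
    α * (γ * coeff (m + ∑ p ∈ N, single p 1) ((∏ p ∈ N, ℓ p) * Q) +
      δ * coeff (m + ∑ p ∈ N, single p 1 + single v 1) (X w * ((∏ p ∈ N, ℓ p) * Q))) := by
  rw [coeff_form_mul_of_eq_zero α β hvx, coeff_form_mul]
  simpa [hmx, hvx] using single_apply_of_notMem hx

include hα hγ hvx hvw hv hx hℓ hmv hmx in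
/-- If the monomial has degree two in `v` and zero in `x` and `w`, then `v` comes from the edges
`vx` and `vw`, so that nothing cancels. -/
theorem coeff_star_ne_zero_of_two (hw : w ∉ N) (hmw : m w = 0) (hm : coeff m Q ≠ 0) :
    coeff (m + ∑ p ∈ N, single p 1 + single v 1 + single v 1)
      ((C α * X v + C β * X x) * ((C γ * X v + C δ * X w) * ((∏ p ∈ N, ℓ p) * Q))) ≠ 0 := by
  rw [coeff_star_two_eq hvx hx hmx, coeff_X_mul_eq_zero, mul_zero, add_zero]
  · exact mul_ne_zero hα (mul_ne_zero hγ ((coeff_star_zero hv hℓ Q hmv).2 hm))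
  · simpa [hmw, hvw] using single_apply_of_notMem hw

include hα hγ hvx hv hx hℓ hmv hmx in
/-- If cancellation makes the coefficient vanish, then a variable `w` of the monomial can be
exchanged for some `p`. -/
theorem exists_coeff_exchange (hQ : ∀ m : V →₀ ℕ, m v ≠ 0 → coeff m Q = 0) (hmw : m w ≠ 0)
    (hm : coeff m Q ≠ 0)
    (h : coeff (m + ∑ p ∈ N, single p 1 + single v 1 + single v 1)
      ((C α * X v + C β * X x) * ((C γ * X v + C δ * X w) * ((∏ p ∈ N, ℓ p) * Q))) = 0) :
    ∃ p ∈ N, coeff (m - single w 1 + single p 1) Q ≠ 0 := by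
  have hsub : m - single w 1 + single w 1 = m :=
    tsub_add_cancel_of_le (Finsupp.single_le_iff.2 (Nat.one_le_iff_ne_zero.2 hmw))
  have h0 : (m - single w 1 : V →₀ ℕ) v = 0 := by simp [hmv]
  refine coeff_star_one hv hℓ hQ h0 fun h1 => ?_
  rw [coeff_star_two_eq hvx hx hmx, show m + ∑ p ∈ N, single p 1 + single v 1 =
      single w 1 + (m - single w 1 + ∑ p ∈ N, single p 1 + single v 1) by
        nth_rw 1 [← hsub]; ac_rfl, coeff_X_mul, h1, mul_zero, add_zero] at h
  exact mul_ne_zero hα (mul_ne_zero hγ ((coeff_star_zero hv hℓ Q hmv).2 hm)) h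

end star

/-- The coefficient of a product at the product of two monomials, when the second factor is
homogeneous and the second monomial avoids the variables of the first factor. -/
theorem coeff_mul_of_separated {P Q : MvPolynomial V F} {k : ℕ} (hQ : Q.IsHomogeneous k)
    {M N : V →₀ ℕ} (hM : coeff M P ≠ 0) (hN : coeff N Q ≠ 0)
    (hsep : ∀ u, N u ≠ 0 → ∀ m, coeff m P ≠ 0 → m u = 0) :
    coeff (M + N) (P * Q) ≠ 0 := by
  classical
  rw [coeff_mul, Finset.sum_eq_single (M, N)]
  · exact mul_ne_zero hM hN
  · rintro ⟨m, n⟩ hmn hne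
    rw [Finset.HasAntidiagonal.mem_antidiagonal] at hmn
    by_contra hcon
    have hm := left_ne_zero_of_mul hcon
    have hn := right_ne_zero_of_mul hcon
    dsimp only at hmn hm hn
    have hle : N ≤ n := by
      intro u
      by_cases hu : N u = 0
      · simp [hu]
      · have := DFunLike.congr_fun hmn u
        simp only [Finsupp.add_apply, hsep u hu m hm, hsep u hu M hM] at this
        omega
    have hd : N.degree = n.degree := by
      rw [Finsupp.degree_eq_weight_one]
      exact (hQ hN).trans (hQ hn).symm
    have hnN : n = N := by
      have h1 := tsub_add_cancel_of_le hle
      have h2 := congrArg Finsupp.degree h1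
      rw [map_add] at h2
      have h3 : (n - N).degree = 0 := by omega
      rw [Finsupp.degree_eq_zero_iff] at h3
      rw [← h1, h3, zero_add]
    subst hnN
    exact hne (Prod.ext (add_right_cancel hmn) rfl)
  · simp

variable [LinearOrder V] (a b : Sym2 V → F)

theorem isHomogeneous_edgePoly (E : Finset (Sym2 V)) :
    (∏ e ∈ E, edgeForm a b e).IsHomogeneous E.card := by
  have := IsHomogeneous.prod E (edgeForm a b) (fun _ => 1) fun e _ =>
    ((isHomogeneous_X F e.inf).C_mul (a e)).add ((isHomogeneous_X F e.sup).C_mul (b e))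
  simpa using this

/-- Only the ends of edges occur in the monomials of an edge polynomial. -/
theorem exists_mem_of_coeff_ne_zero {E : Finset (Sym2 V)} {m : V →₀ ℕ}
    (hm : coeff m (∏ e ∈ E, edgeForm a b e) ≠ 0) {u : V} (hu : m u ≠ 0) :
    ∃ e ∈ E, u ∈ e := by
  classical
  have h1 : u ∈ (∏ e ∈ E, edgeForm a b e).vars :=
    (mem_vars_iff_mem_support u).2
      ⟨m, MvPolynomial.mem_support_iff.2 hm, Finsupp.mem_support_iff.2 hu⟩
  obtain ⟨e, he, h2⟩ := Finset.mem_biUnion.1 (vars_prod (edgeForm a b) h1)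
  refine ⟨e, he, ?_⟩
  induction e with
  | _ p q =>
  have : ∀ r (c : F), (C c * X r : MvPolynomial V F).vars ⊆ {r} := fun r c => by
    refine (vars_mul _ _).trans ?_
    simp
  have h3 := vars_add_subset _ _ h2
  rw [Finset.mem_union] at h3
  rw [Sym2.mem_iff]
  rcases h3 with h3 | h3
  · have := Finset.mem_singleton.1 (this _ _ h3)
    rw [this, Sym2.inf_mk]
    exact min_choice p q
  · have := Finset.mem_singleton.1 (this _ _ h3)
    rw [this, Sym2.sup_mk]
    exact max_choice p q

end algebra

/-! ### The monomial of a triangulated disk -/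

section induction

open MvPolynomial Finsupp

variable {V : Type*} [Fintype V]

open Classical in
/-- The edges of the triangles. -/
noncomputable def edges (T : V → V → V → Prop) : Finset (Sym2 V) :=
  Finset.univ.filter fun e => ∃ a b, e = s(a, b) ∧ Adj T a b

theorem mem_edges {T : V → V → V → Prop} {a b : V} : s(a, b) ∈ edges T ↔ Adj T a b := by
  simp only [edges, Finset.mem_filter, Finset.mem_univ, true_and]
  constructor
  · rintro ⟨c, d, h, hcd⟩
    rcases Sym2.eq_iff.1 h with ⟨rfl, rfl⟩ | ⟨rfl, rfl⟩
    exacts [hcd, hcd.symm]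
  · exact fun h => ⟨a, b, rfl, h⟩

/-- The number of triangles, each counted once for each of its vertices. -/
noncomputable def size (T : V → V → V → Prop) : ℕ :=
  {t : V × V × V | T t.1 t.2.1 t.2.2}.ncard

theorem size_lt {T T' : V → V → V → Prop} (h : ∀ a b c, T' a b c → T a b c) {a b c : V}
    (habc : T a b c) (habc' : ¬ T' a b c) : size T' < size T :=
  Set.ncard_lt_ncard ⟨fun t ht => h _ _ _ ht, fun hsub => habc' (hsub (a := (a, b, c)) habc)⟩

variable [LinearOrder V] {F : Type*} [Field F] {a b : Sym2 V → F}

variable (a b) in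
/-- The monomial `M` occurs in the edge polynomial without the edge `xy`, and it satisfies the
bounds on the degrees. -/
structure IsGood (T : V → V → V → Prop) (x y : V) (M : V →₀ ℕ) : Prop where
  coeff_ne : coeff M (∏ e ∈ (edges T).erase s(x, y), edgeForm a b e) ≠ 0
  left : M x = 0
  right : M y = 0
  bd : ∀ v, BdVertex T v → M v ≤ 2
  le : ∀ v, M v ≤ 4

theorem IsGood.isVertex {T : V → V → V → Prop} {x y : V} {M : V →₀ ℕ}
    (h : coeff M (∏ e ∈ (edges T).erase s(x, y), edgeForm a b e) ≠ 0) {u : V} (hu : M u ≠ 0) :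
    IsVertex T u := by
  obtain ⟨e, he, hue⟩ := exists_mem_of_coeff_ne_zero a b h hu
  obtain ⟨q, rfl⟩ := hue
  exact ⟨q, mem_edges.1 (Finset.mem_of_mem_erase he)⟩

/-- Good monomials for the two sides of a chord multiply to a good monomial: the second one does
not contain the ends of the chord. -/
theorem IsCut.isGood_add {T : V → V → V → Prop} (hT : TriDisk T) {u p x y : V}
    {τ : V → V → ZMod 2} (hc : IsCut T u p τ) (hxy : Bd T x y) (hp : τ p u = τ x y)
    {M N : V →₀ ℕ} (hM : IsGood a b (side T τ (τ x y)) x y M)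
    (hN : IsGood a b (side T τ (τ u p)) u p N) : IsGood a b T x y (M + N) := by
  have hij : τ x y ≠ τ u p := fun h => hc.jump (h.symm.trans hp.symm)
  have htwo : ∀ k, k = τ x y ∨ k = τ u p := by
    intro k
    generalize τ x y = i at *
    generalize τ u p = j at *
    clear hM hN hp
    revert i j k; decide
  have hE : (edges T).erase s(x, y) = (edges (side T τ (τ x y))).erase s(x, y) ∪
      (edges (side T τ (τ u p))).erase s(u, p) := by
    ext e
    induction e with
    | _ q r =>
    simp only [Finset.mem_union, Finset.mem_erase, mem_edges]
    constructor
    · rintro ⟨hne, hqr⟩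
      by_cases hup : s(q, r) = s(u, p)
      · refine Or.inl ⟨hne, ?_⟩
        rcases Sym2.eq_iff.1 hup with ⟨rfl, rfl⟩ | ⟨rfl, rfl⟩
        exacts [hc.adj_side _, (hc.adj_side _).symm]
      · have : ∃ k, Adj (side T τ k) q r := by
          rcases hqr with h | h
          exacts [⟨_, Or.inl (hasTri_side.2 ⟨h, rfl⟩)⟩, ⟨_, Or.inr (hasTri_side.2 ⟨h, rfl⟩)⟩]
        obtain ⟨k, hk⟩ := this
        rcases htwo k with rfl | rfl
        exacts [Or.inl ⟨hne, hk⟩, Or.inr ⟨hup, hk⟩]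
    · rintro (⟨hne, hqr⟩ | ⟨-, hqr⟩)
      · exact ⟨hne, hqr.of_side⟩
      · refine ⟨fun h => ?_, hqr.of_side⟩
        have : Adj (side T τ (τ u p)) x y := by
          rcases Sym2.eq_iff.1 h with ⟨rfl, rfl⟩ | ⟨rfl, rfl⟩
          exacts [hqr, hqr.symm]
        rcases this with h | h <;> rw [hasTri_side] at h
        exacts [hij h.2, hxy.2 h.1]
  have hdisj : Disjoint ((edges (side T τ (τ x y))).erase s(x, y))
      ((edges (side T τ (τ u p))).erase s(u, p)) := by
    rw [Finset.disjoint_left]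
    intro e
    induction e with
    | _ q r =>
    simp only [Finset.mem_erase, mem_edges]
    exact fun h h' => h'.1 (hc.eq_of_adj_side hij h.2 h'.2)
  have hsep : ∀ v, N v ≠ 0 → ¬ IsVertex (side T τ (τ x y)) v := by
    intro v hv hv'
    rcases hT.eq_of_isVertex_side hc hij hv' (IsGood.isVertex hN.coeff_ne hv) with rfl | rfl
    exacts [hv hN.left, hv hN.right]
  have hM0 : ∀ v, N v ≠ 0 → M v = 0 := fun v hv => by
    by_contra h; exact hsep v hv (IsGood.isVertex hM.coeff_ne h)
  have hx : IsVertex (side T τ (τ x y)) x := ⟨y, (bd_side_of_bd hxy rfl).adj⟩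
  have hy : IsVertex (side T τ (τ x y)) y := ⟨x, (bd_side_of_bd hxy rfl).adj.symm⟩
  refine ⟨?_, ?_, ?_, fun v hv => ?_, fun v => ?_⟩
  · rw [hE, Finset.prod_union hdisj]
    refine coeff_mul_of_separated (isHomogeneous_edgePoly a b _) hM.coeff_ne hN.coeff_ne ?_
    intro v hv m hm
    by_contra h
    exact hsep v hv (IsGood.isVertex hm h)
  · have : N x = 0 := by by_contra h; exact hsep x h hx
    simp [hM.left, this]
  · have : N y = 0 := by by_contra h; exact hsep y h hy
    simp [hM.right, this]
  · by_cases h : N v = 0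
    · by_cases h' : M v = 0
      · simp [h, h']
      · simpa [h] using hM.bd v (hT.bdVertex_side hc hv (IsGood.isVertex hM.coeff_ne h'))
    · simpa [hM0 v h] using hN.bd v (hT.bdVertex_side hc hv (IsGood.isVertex hN.coeff_ne h))
  · by_cases h : N v = 0
    · simpa [h] using hM.le v
    · simpa [hM0 v h] using hN.le v

section star

variable {v x w : V} {N : Finset V} (hvx : v ≠ x) (hwx : w ≠ x) (hvw : v ≠ w) (hv : v ∉ N)
  (hx : x ∉ N) (hw : w ∉ N) (hax : a s(v, x) ≠ 0 ∧ b s(v, x) ≠ 0)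
  (haw : a s(v, w) ≠ 0 ∧ b s(v, w) ≠ 0) (haN : ∀ p ∈ N, a s(v, p) ≠ 0 ∧ b s(v, p) ≠ 0)
  {Q : MvPolynomial V F} (hQ : ∀ m : V →₀ ℕ, m v ≠ 0 → coeff m Q = 0)
  {m : V →₀ ℕ} (hm : coeff m Q ≠ 0) (hmx : m x = 0)

omit [Fintype V] in
theorem sum_single_apply (N : Finset V) (u : V) :
    (∑ p ∈ N, single p 1 : V →₀ ℕ) u = if u ∈ N then 1 else 0 := by
  rw [Finsupp.finsetSum_apply]
  simp [Finsupp.single_apply]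

omit [Fintype V] in
include haN in
theorem star_forms (p : V) (hp : p ∈ N) : ∃ α β : F, α ≠ 0 ∧ β ≠ 0 ∧
    edgeForm a b s(v, p) = C α * X p + C β * X v := by
  obtain ⟨α, β, hα, hβ, h⟩ := edgeForm_eq (haN p hp)
  exact ⟨β, α, hβ, hα, by rw [h, add_comm]⟩

omit [Fintype V] in
include hvx hvw hv hx hw hax haw haN hQ hm hmx in
theorem exists_star_of_eq_zero (hmw : m w = 0) : ∃ M : V →₀ ℕ,
    coeff M (edgeForm a b s(v, x) * (edgeForm a b s(v, w) *
      ((∏ p ∈ N, edgeForm a b s(v, p)) * Q))) ≠ 0 ∧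
    M v = 2 ∧ ∀ u, u ≠ v → M u = m u + if u ∈ N then 1 else 0 := by
  have hmv : m v = 0 := by by_contra h; exact hm (hQ m h)
  obtain ⟨α, β, hα, hβ, h1⟩ := edgeForm_eq hax
  obtain ⟨γ, δ, hγ, hδ, h2⟩ := edgeForm_eq haw
  rw [h1, h2]
  refine ⟨_, coeff_star_ne_zero_of_two hα hγ hvx hvw hv hx (star_forms haN) hmv hmx hw hmw hm,
    ?_, fun u hu => ?_⟩
  · simp [-coe_finsetSum, sum_single_apply, hmv, hv]
  · simp [-coe_finsetSum, sum_single_apply, hu]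

omit [Fintype V] in
include hvx hwx hvw hv hx hw hax haw haN hQ hm hmx in
/-- If `w` has degree two, and the monomial with `v ^ 2` cancels, then by exchange there is one
in which `w` has degree one, and this can be extended by `v w`. -/
theorem exists_star_of_le_two (hmw : m w ≤ 2) : ∃ M : V →₀ ℕ,
    coeff M (edgeForm a b s(v, x) * (edgeForm a b s(v, w) *
      ((∏ p ∈ N, edgeForm a b s(v, p)) * Q))) ≠ 0 ∧
    M v ≤ 2 ∧ M w ≤ 2 ∧ ∀ u, u ≠ v → u ≠ w → M u ≤ m u + if u ∈ N then 2 else 0 := by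
  have hmv : m v = 0 := by by_contra h; exact hm (hQ m h)
  obtain ⟨α, β, hα, hβ, h1⟩ := edgeForm_eq hax
  obtain ⟨γ, δ, hγ, hδ, h2⟩ := edgeForm_eq haw
  have hℓ := star_forms haN
  rw [h1, h2]
  by_cases hmw1 : m w ≤ 1
  · refine ⟨_, coeff_star_ne_zero_of_one hα hδ hvx hwx hvw hv hx hℓ hmv hmx hm,
      ?_, ?_, fun u hu huw => ?_⟩
    · simp [-coe_finsetSum, sum_single_apply, hmv, hv, hvw]
    · simpa [-coe_finsetSum, sum_single_apply, hw, hvw.symm] using hmw1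
    · simp only [Finsupp.add_apply, sum_single_apply, single_eq_of_ne hu, single_eq_of_ne huw]
      split_ifs <;> omega
  · by_cases h : coeff (m + ∑ p ∈ N, single p 1 + single v 1 + single v 1)
      ((C α * X v + C β * X x) * ((C γ * X v + C δ * X w) *
        ((∏ p ∈ N, edgeForm a b s(v, p)) * Q))) = 0
    · obtain ⟨p, hp, hmp⟩ := exists_coeff_exchange hα hγ hvx hv hx hℓ hmv hmx hQ
        (by omega) hm h
      have hpv : v ≠ p := by rintro rfl; exact hv hp
      have hpx : x ≠ p := by rintro rfl; exact hx hp
      have hpw : w ≠ p := by rintro rfl; exact hw hp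
      refine ⟨_, coeff_star_ne_zero_of_one hα hδ hvx hwx hvw hv hx hℓ ?_ ?_ hmp,
        ?_, ?_, fun u hu huw => ?_⟩
      · simp [hmv, hpv]
      · simp [hmx, hpx]
      · simp [-coe_finsetSum, sum_single_apply, hmv, hv, hvw, hpv]
      · simp [-coe_finsetSum, sum_single_apply, hw, hvw.symm, hpw]
        omega
      · simp only [Finsupp.add_apply, Finsupp.tsub_apply, sum_single_apply, single_eq_of_ne hu,
          single_eq_of_ne huw]
        by_cases hup : u = p
        · subst hup
          simp [hp]
        · rw [single_eq_of_ne hup]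
          split_ifs <;> omega
    · refine ⟨_, h, ?_, ?_, fun u hu huw => ?_⟩
      · simp [-coe_finsetSum, sum_single_apply, hmv, hv]
      · simpa [-coe_finsetSum, sum_single_apply, hw, hvw.symm] using hmw
      · simp only [Finsupp.add_apply, sum_single_apply, single_eq_of_ne hu]
        split_ifs <;> omega

end star

/-- A good monomial for the disk without an ear extends to one for the whole disk. -/
theorem IsEar.exists_isGood {T : V → V → V → Prop} (hT : TriDisk T) {w v x y : V}
    (hE : IsEar T w v x) (hxy : Bd T x y) (hvy : v ≠ y)
    (hab : ∀ e ∈ (edges T).erase s(x, y), a e ≠ 0 ∧ b e ≠ 0)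
    {m : V →₀ ℕ} (hm : IsGood a b (del T v) x y m) : ∃ M, IsGood a b T x y M := by
  classical
  set N : Finset V := Finset.univ.filter fun p => Inner T v p with hN
  have memN : ∀ p, p ∈ N ↔ Inner T v p := fun p => by simp [hN]
  have hNbd : ∀ p, BdVertex T p → p ∉ N := fun p hp h => hE.chordless ((memN p).1 h) hp
  have hvx : v ≠ x := hT.adj_ne hE.succ.adj
  have hvw : v ≠ w := (hT.adj_ne hE.pred.adj).symm
  have hvN : v ∉ N := hNbd v hE.succ.left
  have hxN : x ∉ N := hNbd x hE.succ.right
  have hwN : w ∉ N := hNbd w hE.pred.left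
  have hyN : y ∉ N := hNbd y hxy.right
  have hstar : ∀ p, Adj T v p → s(v, p) ∈ (edges T).erase s(x, y) := fun p hp => by
    rw [Finset.mem_erase, mem_edges]
    refine ⟨fun h => ?_, hp⟩
    rcases Sym2.eq_iff.1 h with ⟨h, -⟩ | ⟨h, -⟩
    exacts [hvx h, hvy h]
  have hnov : ∀ p q, s(p, q) ∈ (edges (del T v)).erase s(x, y) → p ≠ v ∧ q ≠ v := fun p q h =>
    Adj.ne_of_del (mem_edges.1 (Finset.mem_of_mem_erase h))
  have hEdges : (edges T).erase s(x, y) = insert s(v, x) (insert s(v, w)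
      (N.image (fun p => s(v, p)) ∪ (edges (del T v)).erase s(x, y))) := by
    ext e
    simp only [Finset.mem_insert, Finset.mem_union, Finset.mem_image]
    constructor
    · intro he
      by_cases hve : v ∈ e
      · obtain ⟨q, rfl⟩ := hve
        have hq : Adj T v q := mem_edges.1 (Finset.mem_of_mem_erase he)
        rcases hq.cases with h | h | h
        · exact Or.inr (Or.inr (Or.inl ⟨q, (memN q).2 h, rfl⟩))
        · exact Or.inl (by rw [hT.bd_succ_unique h hE.succ])
        · exact Or.inr (Or.inl (by rw [hT.bd_pred_unique h hE.pred]))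
      · refine Or.inr (Or.inr (Or.inr ?_))
        induction e with
        | _ p q =>
        rw [Sym2.mem_iff] at hve
        push Not at hve
        rw [Finset.mem_erase, mem_edges] at he ⊢
        exact ⟨he.1, hE.keep he.2 hve.1.symm hve.2.symm⟩
    · rintro (rfl | rfl | ⟨p, hp, rfl⟩ | he)
      · exact hstar x hE.succ.adj
      · exact hstar w hE.pred.adj.symm
      · exact hstar p ((memN p).1 hp).adj
      · induction e with
        | _ p q =>
        rw [Finset.mem_erase, mem_edges] at he ⊢
        exact ⟨he.1, he.2.of_del⟩
  have hprod : ∏ e ∈ (edges T).erase s(x, y), edgeForm a b e =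
      edgeForm a b s(v, x) * (edgeForm a b s(v, w) * ((∏ p ∈ N, edgeForm a b s(v, p)) *
        ∏ e ∈ (edges (del T v)).erase s(x, y), edgeForm a b e)) := by
    have hinj : ∀ p q, s(v, p) = s(v, q) → p = q := fun p q h => Sym2.congr_right.1 h
    have h0 : ∀ p, s(v, p) ∉ (edges (del T v)).erase s(x, y) := fun p h => (hnov v p h).1 rfl
    rw [hEdges, Finset.prod_insert, Finset.prod_insert, Finset.prod_union, Finset.prod_image]
    · exact fun p _ q _ h => hinj p q h
    · rw [Finset.disjoint_left]
      intro e he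
      obtain ⟨p, -, rfl⟩ := Finset.mem_image.1 he
      exact h0 p
    · rw [Finset.mem_union, Finset.mem_image]
      rintro (⟨p, hp, h⟩ | h)
      · exact hwN (hinj p w h ▸ hp)
      · exact h0 w h
    · rw [Finset.mem_insert, Finset.mem_union, Finset.mem_image]
      rintro (h | ⟨p, hp, h⟩ | h)
      · exact hE.ne (hinj x w h).symm
      · exact hxN (hinj p x h ▸ hp)
      · exact h0 x h
  have hQ : ∀ k : V →₀ ℕ, k v ≠ 0 →
      coeff k (∏ e ∈ (edges (del T v)).erase s(x, y), edgeForm a b e) = 0 := by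
    intro k hk
    by_contra h
    obtain ⟨q, hq⟩ := IsGood.isVertex h hk
    exact hq.ne_of_del.1 rfl
  have hax := hab _ (hstar x hE.succ.adj)
  have haw := hab _ (hstar w hE.pred.adj.symm)
  have haN : ∀ p ∈ N, a s(v, p) ≠ 0 ∧ b s(v, p) ≠ 0 := fun p hp =>
    hab _ (hstar p ((memN p).1 hp).adj)
  have hNle : ∀ p ∈ N, m p ≤ 2 := fun p hp => hm.bd p (hE.bdVertex_del_of_inner hT ((memN p).1 hp))
  by_cases hwy : w = y
  · subst hwy
    obtain ⟨M, hM, hMv, hMu⟩ := exists_star_of_eq_zero hvx hvw hvN hxN hwN hax haw haN hQ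
      hm.coeff_ne hm.left hm.right
    refine ⟨M, hprod ▸ hM, ?_, ?_, fun u hu => ?_, fun u => ?_⟩
    · simp [hMu x hvx.symm, hm.left, hxN]
    · simp [hMu w hvw.symm, hm.right, hwN]
    · by_cases huv : u = v
      · exact huv ▸ hMv.le
      · simpa [hMu u huv, hNbd u hu] using hm.bd u (hE.bdVertex_del hT hu huv)
    · by_cases huv : u = v
      · subst huv; omega
      · have h1 := hMu u huv
        have h2 := hm.le u
        split_ifs at h1 with hu
        · have := hNle u hu
          omega
        · omega
  · obtain ⟨M, hM, hMv, hMw, hMu⟩ := exists_star_of_le_two hvx hE.ne hvw hvN hxN hwN hax haw haN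
      hQ hm.coeff_ne hm.left (hm.bd w (hE.bdVertex_del hT hE.pred.left hvw.symm))
    refine ⟨M, hprod ▸ hM, ?_, ?_, fun u hu => ?_, fun u => ?_⟩
    · simpa [hm.left, hxN] using hMu x hvx.symm hE.ne.symm
    · simpa [hm.right, hyN] using hMu y hvy.symm (Ne.symm hwy)
    · by_cases huv : u = v
      · exact huv ▸ hMv
      by_cases huw : u = w
      · exact huw ▸ hMw
      have h1 := hMu u huv huw
      rw [if_neg (hNbd u hu)] at h1
      exact h1.trans (hm.bd u (hE.bdVertex_del hT hu huv))
    · by_cases huv : u = v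
      · subst huv; omega
      by_cases huw : u = w
      · subst huw; omega
      have h1 := hMu u huv huw
      have h2 := hm.le u
      split_ifs at h1 with hu
      · have := hNle u hu
        omega
      · omega

/-- For a single triangle `vxw` the monomial is `v ^ 2`. -/
theorem exists_isGood_of_triangle {T : V → V → V → Prop} (hT : TriDisk T) {w v x : V}
    (hw : Bd T w v) (hx : Bd T v x) (hxw : Bd T x w) (h : T v x w)
    (hab : ∀ e ∈ (edges T).erase s(x, w), a e ≠ 0 ∧ b e ≠ 0) : ∃ M, IsGood a b T x w M := by
  have hvx : v ≠ x := hT.adj_ne hx.adj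
  have hvw : v ≠ w := (hT.adj_ne hw.adj).symm
  have hwx : w ≠ x := (hT.adj_ne hxw.adj).symm
  have hE : (edges T).erase s(x, w) = insert s(v, x) {s(v, w)} := by
    ext e
    induction e with
    | _ p q =>
    rw [Finset.mem_erase, mem_edges, Finset.mem_insert, Finset.mem_singleton]
    constructor
    · rintro ⟨hne, hpq⟩
      rcases hT.adj_of_triangle hx hxw hw h hpq with h | h | h
      · exact Or.inl h
      · exact absurd h hne
      · exact Or.inr (h.trans Sym2.eq_swap)
    · simp only [Sym2.eq_iff]
      rintro (⟨⟨rfl, rfl⟩ | ⟨rfl, rfl⟩⟩ | ⟨⟨rfl, rfl⟩ | ⟨rfl, rfl⟩⟩)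
      · exact ⟨by rw [Ne, Sym2.eq_iff]; grind, hx.adj⟩
      · exact ⟨by rw [Ne, Sym2.eq_iff]; grind, hx.adj.symm⟩
      · exact ⟨by rw [Ne, Sym2.eq_iff]; grind, hw.adj.symm⟩
      · exact ⟨by rw [Ne, Sym2.eq_iff]; grind, hw.adj⟩
  have hne : s(v, x) ≠ s(v, w) := fun h => hwx (Sym2.congr_right.1 h).symm
  have hx' := hab s(v, x) (by rw [hE]; simp)
  have hw' := hab s(v, w) (by rw [hE]; simp)
  obtain ⟨M, hM, hMv, hMu⟩ := exists_star_of_eq_zero (m := 0) (Q := 1) (N := ∅) hvx hvw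
    (by simp) (by simp) (by simp) hx' hw' (by simp)
    (fun k hk => by
      classical
      rw [coeff_one, if_neg]
      rintro rfl
      exact hk rfl) (by simp) rfl rfl
  have hM2 : ∀ u, M u ≤ 2 := fun u => by
    by_cases hu : u = v
    · exact hu ▸ hMv.le
    · simp [hMu u hu]
  refine ⟨M, ?_, by simp [hMu x hvx.symm], by simp [hMu w hvw.symm], fun u _ => hM2 u,
    fun u => (hM2 u).trans (by norm_num)⟩
  rw [hE, Finset.prod_insert (by simpa using hne), Finset.prod_singleton]
  simpa using hM

theorem IsGood.symm {T : V → V → V → Prop} {x y : V} {M : V →₀ ℕ} (h : IsGood a b T x y M) :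
    IsGood a b T y x M :=
  ⟨by rw [Sym2.eq_swap]; exact h.coeff_ne, h.right, h.left, h.bd, h.le⟩

/-- A triangulated disk with a distinguished boundary edge `xy` has a good monomial. -/
theorem exists_isGood (n : ℕ) : ∀ {T : V → V → V → Prop}, TriDisk T → size T = n →
    ∀ {x y : V}, Bd T x y → (∀ e ∈ (edges T).erase s(x, y), a e ≠ 0 ∧ b e ≠ 0) →
    ∃ M, IsGood a b T x y M := by
  induction n using Nat.strong_induction_on with
  | _ n ih =>
  intro T hT hn x y hxy hab
  obtain ⟨v, hv⟩ := hT.exists_bd_pred hxy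
  obtain ⟨w, hw⟩ := hT.exists_bd_pred hv
  have hvy : v ≠ y := by rintro rfl; exact hxy.2 hv.1
  by_cases hch : ∀ p, Inner T v p → ¬ BdVertex T p
  · rcases hT.isEar_or hw hv hch with hE | ⟨h, hxw⟩
    · obtain ⟨c, hc⟩ := id hv.1
      obtain ⟨m, hm⟩ := ih _ (hn ▸ size_lt (fun _ _ _ h => h.1) hc fun h => h.2.1 rfl)
        (hT.del_triDisk hE) rfl (hE.bd_del hxy (hT.adj_ne hv.adj).symm hvy.symm)
        (fun e he => hab e (by
          induction e with
          | _ p q =>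
          rw [Finset.mem_erase, mem_edges] at he ⊢
          exact ⟨he.1, he.2.of_del⟩))
      exact hE.exists_isGood hT hxy hvy hab hm
    · obtain rfl := hT.bd_succ_unique hxy hxw
      exact hT.exists_isGood_of_triangle hw hv hxy h hab
  · push Not at hch
    obtain ⟨q, hvq, hq⟩ := hch
    obtain ⟨τ, hτ⟩ := hT.exists_isCut hvq hv.left hq
    -- name the ends of the chord so that `xy` is to the right of the dart from `u` to `p`
    obtain ⟨u, p, hc, hp⟩ : ∃ u p, IsCut T u p τ ∧ τ p u = τ x y := by
      have h2 : τ q v = τ x y ∨ τ v q = τ x y := by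
        have := hτ.jump
        generalize τ v q = k at *
        generalize τ q v = l at *
        generalize τ x y = i at *
        clear hτ ih
        revert k l i; decide
      rcases h2 with h | h
      exacts [⟨v, q, hτ, h⟩, ⟨q, v, hτ.symm, h⟩]
    have hij : τ x y ≠ τ u p := fun h => hc.jump (h.symm.trans hp.symm)
    obtain ⟨c, hxyc⟩ := id hxy.1
    obtain ⟨d, hupd⟩ := id hc.inner.1
    have hsub : ∀ i e, e ∈ edges (side T τ i) → e ∈ edges T := by
      intro i e he
      induction e with
      | _ q r => exact mem_edges.2 (mem_edges.1 he).of_side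
    obtain ⟨M, hM⟩ := ih _ (hn ▸ size_lt (fun _ _ _ h => h.1) hupd fun h => hij h.2.symm)
      (hT.side_triDisk hc (τ x y)) rfl (bd_side_of_bd hxy rfl)
      (fun e he => hab e (Finset.erase_subset_erase _ (hsub _) he))
    obtain ⟨N, hN⟩ := ih _ (hn ▸ size_lt (fun _ _ _ h => h.1) hxyc fun h => hij h.2)
      (hT.side_triDisk hc (τ u p)) rfl hc.bd_side
      (fun e he => hab e (by
        rw [Finset.mem_erase] at he ⊢
        refine ⟨?_, hsub _ _ he.2⟩
        rintro rfl
        rcases mem_edges.1 he.2 with h | h <;> rw [hasTri_side] at h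
        exacts [hij h.2, hxy.2 h.1]))
    exact ⟨M + N, hc.isGood_add hT hxy hp hM hN⟩

end induction

end TriDisk

namespace RotationSystem

open TriDisk

/-! ### The triangulated surface of a near-triangulation -/

section surface

variable {V : Type*} {G : SimpleGraph V} (R : RotationSystem G)

theorem facePerm_apply (d : G.Dart) : R.facePerm d = R.next d.symm := rfl

theorem next_fst (d : G.Dart) : (R.next d).fst = d.fst :=
  ((R.sameCycle_iff d (R.next d)).1 (Equiv.Perm.SameCycle.refl _ _).apply_right).symm

theorem facePerm_fst (d : G.Dart) : (R.facePerm d).fst = d.snd := R.next_fst d.symm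

theorem faceOf_eq_iff {d d' : G.Dart} :
    R.faceOf d = R.faceOf d' ↔ R.facePerm.SameCycle d d' := Quotient.eq

theorem faceOf_facePerm (d : G.Dart) : R.faceOf (R.facePerm d) = R.faceOf d :=
  R.faceOf_eq_iff.2 (Equiv.Perm.SameCycle.refl _ _).apply_left

theorem dart_ext {d d' : G.Dart} (h₁ : d.fst = d'.fst) (h₂ : d.snd = d'.snd) : d = d' :=
  SimpleGraph.Dart.ext _ _ (Prod.ext h₁ h₂)

/-- The triangles of the embedding other than the outer face, oriented by the face
permutation. -/
def triangles (outer : R.Face) (a b c : V) : Prop :=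
  ∃ d : G.Dart, d.fst = a ∧ d.snd = b ∧ (R.facePerm d).snd = c ∧ R.faceOf d ≠ outer

variable {R} {outer : R.Face}

theorem hasTri_triangles {a b : V} : HasTri (R.triangles outer) a b ↔
    ∃ d : G.Dart, d.fst = a ∧ d.snd = b ∧ R.faceOf d ≠ outer :=
  ⟨fun ⟨_, d, h₁, h₂, _, h₃⟩ => ⟨d, h₁, h₂, h₃⟩, fun ⟨d, h₁, h₂, h₃⟩ => ⟨_, d, h₁, h₂, rfl, h₃⟩⟩

theorem hasTri_dart {d : G.Dart} : HasTri (R.triangles outer) d.fst d.snd ↔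
    R.faceOf d ≠ outer := by
  rw [hasTri_triangles]
  exact ⟨fun ⟨d', h₁, h₂, h₃⟩ => dart_ext h₁ h₂ ▸ h₃, fun h => ⟨d, rfl, rfl, h⟩⟩

theorem hasTri_dart_symm {d : G.Dart} : HasTri (R.triangles outer) d.snd d.fst ↔
    R.faceOf d.symm ≠ outer := hasTri_dart (d := d.symm)

theorem IsNearTriangulation.facePerm_pow_three (hG : R.IsNearTriangulation outer)
    {d : G.Dart} (hd : R.faceOf d ≠ outer) :
    R.facePerm (R.facePerm (R.facePerm d)) = d := by
  classical
  have h3 := hG.inner_triangle _ hd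
  have hfin : (R.faceDarts (R.faceOf d)).Finite := Set.finite_of_ncard_ne_zero (by omega)
  have hcyc : R.facePerm.IsCycleOn (hfin.toFinset : Set G.Dart) := by
    rw [Set.Finite.coe_toFinset]
    refine ⟨R.facePerm.bijOn fun x => ?_, fun x hx y hy => ?_⟩
    · simp only [faceDarts, Set.mem_ofPred_eq, faceOf_facePerm]
    · exact R.faceOf_eq_iff.1 (hx.trans hy.symm)
  have := hcyc.pow_card_apply (a := d) (by simp [faceDarts])
  rw [← Set.ncard_eq_toFinset_card _ hfin, h3] at this
  exact this

/-- The links of the triangulated surface are traversed by the rotation system. -/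
theorem IsNearTriangulation.triangles_next (hG : R.IsNearTriangulation outer)
    {d : G.Dart} (hd : R.faceOf (R.next d) ≠ outer) :
    R.triangles outer d.fst (R.next d).snd d.snd := by
  refine ⟨R.next d, R.next_fst d, rfl, ?_, hd⟩
  have h1 : R.facePerm d.symm = R.next d := by
    rw [facePerm_apply, SimpleGraph.Dart.symm_symm]
  have h2 : R.facePerm (R.facePerm (R.next d)) = d.symm :=
    R.facePerm.injective ((hG.facePerm_pow_three hd).trans h1.symm)
  rw [← R.facePerm_fst, h2]
  rfl

variable [Finite V] (hG : R.IsNearTriangulation outer)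
include hG

/-- An edge that had the outer face on both sides would, as the outer boundary repeats no vertex,
be the whole outer boundary. -/
theorem IsNearTriangulation.faceOf_symm_ne {d : G.Dart} (hd : R.faceOf d = outer) :
    R.faceOf d.symm ≠ outer := by
  classical
  intro hd'
  have := Fintype.ofFinite V
  have key : ∀ d : G.Dart, R.faceOf d = outer → R.faceOf d.symm = outer →
      R.facePerm d = d.symm := fun d h h' =>
    hG.outer_injOn ((R.faceOf_facePerm d).trans h) h' (R.facePerm_fst d)
  have h1 := key d hd hd'
  have h2 := key d.symm hd' hd
  rw [SimpleGraph.Dart.symm_symm] at h2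
  have hsub : R.faceDarts outer ⊆ {d, d.symm} := by
    intro d' h'
    obtain ⟨n, rfl⟩ := (R.faceOf_eq_iff.1 (hd.trans h'.symm)).exists_nat_pow_eq
    clear h'
    induction n with
    | zero => simp
    | succ n ih =>
      rw [pow_succ', Equiv.Perm.mul_apply]
      rcases ih with h | h <;> rw [h]
      · simp [h1]
      · simp [h2]
  have := Set.ncard_le_ncard hsub
  have := Set.ncard_insert_le d {d.symm}
  rw [Set.ncard_singleton] at this
  have := hG.three_le_outer
  omega

theorem IsNearTriangulation.adj_triangles {a b : V} :
    Adj (R.triangles outer) a b ↔ G.Adj a b := by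
  constructor
  · rintro (h | h) <;> obtain ⟨d, rfl, rfl, -⟩ := hasTri_triangles.1 h
    exacts [d.adj, d.adj.symm]
  · intro h
    by_cases hd : R.faceOf ⟨(a, b), h⟩ = outer
    · exact Or.inr (hasTri_dart_symm.2 (hG.faceOf_symm_ne hd))
    · exact Or.inl (hasTri_dart.2 hd)

theorem IsNearTriangulation.triSurface : TriSurface (R.triangles outer) where
  cyc := by
    rintro a b c ⟨d, rfl, rfl, rfl, hd⟩
    refine ⟨R.facePerm d, R.facePerm_fst d, rfl, ?_, (R.faceOf_facePerm d).trans_ne hd⟩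
    rw [← R.facePerm_fst, hG.facePerm_pow_three hd]
  uniq := by
    rintro a b c c' ⟨d, rfl, rfl, rfl, hd⟩ ⟨d', h₁, h₂, rfl, hd'⟩
    rw [dart_ext h₁ h₂]
  ne := by
    rintro a b c ⟨d, rfl, rfl, rfl, hd⟩
    exact d.adj.ne
  link := by
    classical
    intro a f hf p q hp hq
    have := Fintype.ofFinite V
    rw [hG.adj_triangles] at hp hq
    -- start at the dart with the outer face on its left, if there is one
    obtain ⟨d₀, h₀, houter⟩ : ∃ d₀ : G.Dart, d₀.fst = a ∧
        ∀ d : G.Dart, d.fst = a → R.faceOf d = outer → d = d₀ := by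
      by_cases h : ∃ d : G.Dart, d.fst = a ∧ R.faceOf d = outer
      · obtain ⟨d₀, h₀, h₁⟩ := h
        exact ⟨d₀, h₀, fun d h h' => hG.outer_injOn h' h₁ (h.trans h₀.symm)⟩
      · exact ⟨⟨(a, p), hp⟩, rfl, fun d h₁ h₂ => absurd ⟨d, h₁, h₂⟩ h⟩
    have key : ∀ n : ℕ, ((R.next ^ n) d₀).fst = a ∧ (f ((R.next ^ n) d₀).snd ↔ f d₀.snd) := by
      intro n
      induction n with
      | zero => exact ⟨h₀, Iff.rfl⟩
      | succ n ih =>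
        rw [pow_succ', Equiv.Perm.mul_apply]
        set d := (R.next ^ n) d₀
        have h1 : (R.next d).fst = a := (R.next_fst d).trans ih.1
        refine ⟨h1, ?_⟩
        by_cases hd : R.faceOf (R.next d) = outer
        · rw [houter _ h1 hd]
        · rw [← ih.2]
          exact hf _ _ (ih.1 ▸ hG.triangles_next hd)
    have key' : ∀ r, G.Adj a r → (f r ↔ f d₀.snd) := by
      intro r hr
      obtain ⟨n, hn⟩ := ((R.sameCycle_iff d₀ ⟨(a, r), hr⟩).2 h₀).exists_nat_pow_eq
      have := (key n).2
      rwa [hn] at this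
    exact (key' p hp).trans (key' q hq).symm
  conn := by
    intro f hf p q hp hq
    clear hp hq
    obtain ⟨w⟩ := hG.isPlane.connected.preconnected p q
    induction w with
    | nil => rfl
    | cons h _ ih => exact (hf _ _ (hG.adj_triangles.2 h)).trans ih

theorem IsNearTriangulation.bd_triangles {d : G.Dart} (hd : R.faceOf d = outer) :
    Bd (R.triangles outer) d.snd d.fst :=
  ⟨hasTri_dart_symm.2 (hG.faceOf_symm_ne hd), fun h => hasTri_dart.1 h hd⟩

theorem IsNearTriangulation.bdVertex_triangles {v : V} :
    BdVertex (R.triangles outer) v ↔ R.OnBoundary outer v := by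
  constructor
  · rintro ⟨b, h | h⟩ <;> obtain ⟨⟨d, rfl, rfl, -⟩, h₂⟩ := And.imp_left hasTri_triangles.1 h
    · rw [hasTri_dart_symm, not_not] at h₂
      exact ⟨R.facePerm d.symm, (R.faceOf_facePerm _).trans h₂, R.facePerm_fst _⟩
    · rw [hasTri_dart_symm, not_not] at h₂
      exact ⟨d.symm, h₂, rfl⟩
  · rintro ⟨d, hd, rfl⟩
    exact (hG.bd_triangles hd).right

theorem IsNearTriangulation.inner_triangles {a b : V} :
    Inner (R.triangles outer) a b ↔ G.Adj a b ∧ s(a, b) ∉ R.boundaryEdges outer := by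
  rw [← hG.adj_triangles]
  constructor
  · refine fun h => ⟨h.adj, ?_⟩
    rintro ⟨d, hd, he⟩
    have := (hG.bd_triangles hd).2
    rcases Sym2.eq_iff.1 he with ⟨rfl, rfl⟩ | ⟨rfl, rfl⟩
    exacts [this h.1, this h.2]
  · rintro ⟨h, hn⟩
    rcases h.cases with h | h | h
    · exact h
    · obtain ⟨⟨d, rfl, rfl, -⟩, h₂⟩ := And.imp_left hasTri_triangles.1 h
      rw [hasTri_dart_symm, not_not] at h₂
      exact absurd ⟨d.symm, h₂, d.edge_symm⟩ hn
    · obtain ⟨⟨d, rfl, rfl, -⟩, h₂⟩ := And.imp_left hasTri_triangles.1 h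
      rw [hasTri_dart_symm, not_not] at h₂
      exact absurd ⟨d.symm, h₂, rfl⟩ hn

end surface

end RotationSystem

/-! ### Relative homology from Euler's formula -/

/-- Exactness by counting dimensions: `N * M = 0`, the rows of `N` are independent and the kernel
of `M` is at most one-dimensional. -/
theorem Matrix.exists_mulVec_eq_of_card {K m n p : Type*} [Field K] [Fintype m] [Fintype n]
    [Fintype p] {N : Matrix m n K} {M : Matrix n p K} (hNM : N * M = 0)
    (hN : ∀ f, Matrix.vecMul f N = 0 → f = 0) (hM : ∀ g, M.mulVec g = 0 → ∀ i j, g i = g j)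
    (hcard : Fintype.card m + Fintype.card p = Fintype.card n + 1) {z : n → K}
    (hz : N.mulVec z = 0) : ∃ g, M.mulVec g = z := by
  classical
  have h1 : Module.finrank K (LinearMap.range N.mulVecLin) = Fintype.card m := by
    change N.rank = _
    have hinj : Function.Injective N.transpose.mulVecLin := by
      rw [← LinearMap.ker_eq_bot, LinearMap.ker_eq_bot']
      intro f hf
      rw [Matrix.mulVecLin_apply, Matrix.mulVec_transpose] at hf
      exact hN f hf
    rw [← Matrix.rank_transpose, Matrix.rank, LinearMap.finrank_range_of_inj hinj,
      Module.finrank_fintype_fun_eq_card]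
  have h2 : Module.finrank K (LinearMap.ker M.mulVecLin) ≤ 1 := by
    rcases isEmpty_or_nonempty p with hp | ⟨⟨i⟩⟩
    · exact (Submodule.finrank_le _).trans (by simp)
    · refine (Submodule.finrank_mono (t := K ∙ (fun _ => (1 : K))) ?_).trans
        (finrank_span_singleton fun h => one_ne_zero (congrFun h i)).le
      intro g hg
      rw [LinearMap.mem_ker, Matrix.mulVecLin_apply] at hg
      rw [Submodule.mem_span_singleton]
      exact ⟨g i, funext fun j => by simp [hM g hg i j]⟩
  have h3 := LinearMap.finrank_range_add_finrank_ker N.mulVecLin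
  have h4 := LinearMap.finrank_range_add_finrank_ker M.mulVecLin
  rw [Module.finrank_fintype_fun_eq_card] at h3 h4
  have hle : LinearMap.range M.mulVecLin ≤ LinearMap.ker N.mulVecLin := by
    rintro _ ⟨g, rfl⟩
    simp [hNM]
  have heq := Submodule.eq_of_le_of_finrank_le hle (by omega)
  have hmem : z ∈ LinearMap.ker N.mulVecLin := by simpa using hz
  rw [← heq] at hmem
  exact hmem

namespace RotationSystem

open TriDisk

section homology

variable {V : Type*} {G : SimpleGraph V} {R : RotationSystem G} {outer : R.Face}

/-- The inner vertices, the inner edges and the inner faces together satisfy Euler's formula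
for the disk relative to its boundary circle. -/
theorem IsNearTriangulation.card_relative [Finite V] (hG : R.IsNearTriangulation outer) :
    Nat.card {v // ¬ R.OnBoundary outer v} + Nat.card {f : R.Face // f ≠ outer} =
      Nat.card {e // e ∈ G.edgeSet ∧ e ∉ R.boundaryEdges outer} + 1 := by
  classical
  have := Fintype.ofFinite V
  have hfin : Finite R.Face := Quotient.finite _
  have hV : {v | R.OnBoundary outer v}.ncard = (R.faceDarts outer).ncard :=
    Set.InjOn.ncard_image hG.outer_injOn
  have hE : (R.boundaryEdges outer).ncard = (R.faceDarts outer).ncard := by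
    refine Set.InjOn.ncard_image fun d hd d' hd' h => ?_
    rcases (SimpleGraph.dart_edge_eq_iff d d').1 h with h | rfl
    · exact h
    · exact absurd hd (hG.faceOf_symm_ne hd')
  have hsub : R.boundaryEdges outer ⊆ G.edgeSet := by
    rintro _ ⟨d, -, rfl⟩
    exact d.edge_mem
  have h1 := Set.ncard_add_ncard_compl {v | R.OnBoundary outer v}
  have h2 := Set.ncard_sdiff_add_ncard_of_subset hsub
  have h3 := Set.ncard_add_ncard_compl {outer}
  rw [Set.ncard_singleton] at h3
  have h4 := hG.isPlane.euler
  have e1 : Nat.card {v // ¬ R.OnBoundary outer v} = {v | R.OnBoundary outer v}ᶜ.ncard := rfl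
  have e2 : Nat.card {f : R.Face // f ≠ outer} = ({outer} : Set R.Face)ᶜ.ncard := rfl
  have e3 : Nat.card {e // e ∈ G.edgeSet ∧ e ∉ R.boundaryEdges outer} =
    (G.edgeSet \ R.boundaryEdges outer).ncard := rfl
  have e4 : Nat.card G.edgeSet = G.edgeSet.ncard := rfl
  omega

open Classical in
/-- The incidence matrix of inner vertices and inner edges. -/
noncomputable def vertexEdge (R : RotationSystem G) (outer : R.Face) :
    Matrix {v // ¬ R.OnBoundary outer v} {e // e ∈ G.edgeSet ∧ e ∉ R.boundaryEdges outer}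
      (ZMod 2) :=
  fun v e => if v.1 ∈ e.1 then 1 else 0

open Classical in
/-- The incidence matrix of inner edges and inner faces: the entry counts the sides of the edge
that are on the face. -/
noncomputable def edgeFace [Fintype V] (R : RotationSystem G) (outer : R.Face) :
    Matrix {e // e ∈ G.edgeSet ∧ e ∉ R.boundaryEdges outer} {f : R.Face // f ≠ outer} (ZMod 2) :=
  fun e f => ∑ d : G.Dart, if d.edge = e.1 ∧ R.faceOf d = f.1 then 1 else 0

open Classical in
/-- A function of the inner faces as a function of ordered pairs of vertices, with value zero
where there is no inner face. -/
noncomputable def faceFun (R : RotationSystem G) (outer : R.Face)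
    (g : {f : R.Face // f ≠ outer} → ZMod 2) (a b : V) : ZMod 2 :=
  if h : ∃ h : G.Adj a b, R.faceOf ⟨(a, b), h⟩ ≠ outer then g ⟨_, h.2⟩ else 0

theorem faceFun_dart {g : {f : R.Face // f ≠ outer} → ZMod 2} {d : G.Dart}
    (hd : R.faceOf d ≠ outer) : R.faceFun outer g d.fst d.snd = g ⟨R.faceOf d, hd⟩ :=
  dif_pos ⟨d.adj, hd⟩

theorem faceFun_triangles {g : {f : R.Face // f ≠ outer} → ZMod 2} {a b c : V}
    (h : R.triangles outer a b c) : R.faceFun outer g a b = R.faceFun outer g b c := by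
  obtain ⟨d, rfl, rfl, rfl, hd⟩ := h
  have hd' : R.faceOf (R.facePerm d) ≠ outer := (R.faceOf_facePerm d).trans_ne hd
  rw [faceFun_dart hd, ← R.facePerm_fst, faceFun_dart hd']
  simp only [R.faceOf_facePerm]

variable [Fintype V]

open Classical in
theorem edgeFace_mulVec [Fintype {f : R.Face // f ≠ outer}]
    (g : {f : R.Face // f ≠ outer} → ZMod 2) {a b : V}
    (h : s(a, b) ∈ G.edgeSet ∧ s(a, b) ∉ R.boundaryEdges outer) :
    (R.edgeFace outer).mulVec g ⟨s(a, b), h⟩ = R.faceFun outer g a b + R.faceFun outer g b a := by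
  have hab : G.Adj a b := h.1
  set d : G.Dart := ⟨(a, b), hab⟩ with hd
  have hin : ∀ d' : G.Dart, d'.edge = d.edge → R.faceOf d' ≠ outer := fun d' h' h'' =>
    h.2 ⟨d', h'', h'⟩
  have h1 : ∀ d' : G.Dart, (∑ f : {f : R.Face // f ≠ outer},
      (if d'.edge = d.edge ∧ R.faceOf d' = f.1 then (1 : ZMod 2) else 0) * g f) =
      if d'.edge = d.edge then R.faceFun outer g d'.fst d'.snd else 0 := by
    intro d'
    split_ifs with hd'
    · rw [faceFun_dart (hin d' hd'), Finset.sum_eq_single ⟨R.faceOf d', hin d' hd'⟩]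
      · simp [hd']
      · intro f _ hf
        rw [if_neg, zero_mul]
        exact fun h => hf (Subtype.ext h.2.symm)
      · simp
    · simp [hd']
  have hne : d ≠ d.symm := d.symm_ne.symm
  calc (R.edgeFace outer).mulVec g ⟨s(a, b), h⟩
      = ∑ f : {f : R.Face // f ≠ outer}, ∑ d' : G.Dart,
        (if d'.edge = d.edge ∧ R.faceOf d' = f.1 then (1 : ZMod 2) else 0) * g f := by
        simp only [Matrix.mulVec, dotProduct, edgeFace, Finset.sum_mul]
        rfl
    _ = ∑ d' : G.Dart, if d'.edge = d.edge then R.faceFun outer g d'.fst d'.snd else 0 := by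
        rw [Finset.sum_comm]
        exact Finset.sum_congr rfl fun d' _ => h1 d'
    _ = _ := by
        have hfib : Finset.univ.filter (fun d' : G.Dart => d'.edge = d.edge) = {d, d.symm} :=
          Finset.ext fun d' => by simpa using SimpleGraph.dart_edge_eq_iff d' d
        rw [← Finset.sum_filter, hfib, Finset.sum_pair hne]
        rfl

open Classical in
/-- The boundary of a boundary vanishes: every face enters an inner vertex as often as it leaves
it. -/
theorem vertexEdge_mul_edgeFace [Fintype {e // e ∈ G.edgeSet ∧ e ∉ R.boundaryEdges outer}]
    (hbd : ∀ e ∈ R.boundaryEdges outer, ∀ v ∈ e, R.OnBoundary outer v) :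
    R.vertexEdge outer * R.edgeFace outer = 0 := by
  ext w f
  have h1 : ∀ d : G.Dart, (∑ e : {e // e ∈ G.edgeSet ∧ e ∉ R.boundaryEdges outer},
      (if w.1 ∈ e.1 then (1 : ZMod 2) else 0) *
        (if d.edge = e.1 ∧ R.faceOf d = f.1 then 1 else 0)) =
      (if d.fst = w.1 ∧ R.faceOf d = f.1 then 1 else 0) +
      (if (R.facePerm d).fst = w.1 ∧ R.faceOf (R.facePerm d) = f.1 then 1 else 0) := by
    intro d
    rw [R.facePerm_fst, R.faceOf_facePerm]
    by_cases hf : R.faceOf d = f.1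
    swap
    · simp [hf]
    simp only [hf, and_true]
    by_cases hw : w.1 ∈ d.edge
    · have hd : d.edge ∈ G.edgeSet ∧ d.edge ∉ R.boundaryEdges outer :=
        ⟨d.edge_mem, fun h => w.2 (hbd _ h _ hw)⟩
      rw [Finset.sum_eq_single ⟨d.edge, hd⟩]
      · have hne := d.adj.ne
        rcases Sym2.mem_iff.1 hw with h | h
        · simp [hw, ← h, h ▸ hne.symm]
        · simp [hw, ← h, h ▸ hne]
      · intro e _ he
        have hne : d.edge ≠ e.1 := fun h => he (Subtype.ext h.symm)
        simp [hne]
      · simp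
    · have hw' : ¬ d.fst = w.1 ∧ ¬ d.snd = w.1 :=
        ⟨fun h => hw (h ▸ Sym2.mem_mk_left _ _), fun h => hw (h ▸ Sym2.mem_mk_right _ _)⟩
      rw [if_neg hw'.1, if_neg hw'.2, add_zero]
      refine Finset.sum_eq_zero fun e _ => ?_
      split_ifs with h2 h3 <;> simp_all
  calc (R.vertexEdge outer * R.edgeFace outer) w f
      = ∑ e : {e // e ∈ G.edgeSet ∧ e ∉ R.boundaryEdges outer}, ∑ d : G.Dart,
        (if w.1 ∈ e.1 then (1 : ZMod 2) else 0) *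
          (if d.edge = e.1 ∧ R.faceOf d = f.1 then 1 else 0) := by
        simp only [Matrix.mul_apply, vertexEdge, edgeFace, Finset.mul_sum]
    _ = 0 := by
        rw [Finset.sum_comm, Finset.sum_congr rfl fun d _ => h1 d, Finset.sum_add_distrib,
          Equiv.sum_comp R.facePerm
            (fun d => if d.fst = w.1 ∧ R.faceOf d = f.1 then (1 : ZMod 2) else 0),
          CharTwo.add_self_eq_zero]

open Classical in
/-- The rows of the vertex-edge matrix are independent: a function on the vertices that vanishes on
the boundary and does not change along edges vanishes, by connectedness. -/
theorem IsNearTriangulation.eq_zero_of_vecMul (hG : R.IsNearTriangulation outer)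
    (hbd : ∀ e ∈ R.boundaryEdges outer, ∀ v ∈ e, R.OnBoundary outer v)
    [Fintype {v // ¬ R.OnBoundary outer v}] (f : {v // ¬ R.OnBoundary outer v} → ZMod 2)
    (hf : Matrix.vecMul f (R.vertexEdge outer) = 0) : f = 0 := by
  set g : V → ZMod 2 := fun v => if h : ¬ R.OnBoundary outer v then f ⟨v, h⟩ else 0 with hg
  have hg0 : ∀ v, R.OnBoundary outer v → g v = 0 := fun v hv => by simp [hg, hv]
  have hgf : ∀ v, g v.1 = f v := fun v => by simp [hg, v.2]
  have hadj : ∀ a b, G.Adj a b → g a = g b := by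
    intro a b hab
    by_cases he : s(a, b) ∈ R.boundaryEdges outer
    · rw [hg0 a (hbd _ he a (Sym2.mem_mk_left _ _)), hg0 b (hbd _ he b (Sym2.mem_mk_right _ _))]
    · have h1 := congrFun hf ⟨s(a, b), hab, he⟩
      have h2 : Matrix.vecMul f (R.vertexEdge outer) ⟨s(a, b), hab, he⟩ =
          ∑ v, if v ∈ ({a, b} : Finset V) then g v else 0 := by
        rw [← Finset.sum_subset (Finset.subset_univ
          (Finset.univ.filter fun v => ¬ R.OnBoundary outer v)),
          Finset.sum_subtype (p := fun v => ¬ R.OnBoundary outer v) _ (by simp)]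
        · simp only [Matrix.vecMul, dotProduct, vertexEdge, hgf]
          refine Finset.sum_congr rfl fun v _ => ?_
          simp
        · intro v _ hv
          rw [hg0 v (by simpa using hv), ite_self]
      rw [h2, Finset.sum_ite_mem, Finset.univ_inter, Finset.sum_pair hab.ne] at h1
      exact CharTwo.add_eq_zero.1 h1
  have hconst : ∀ p q, g p = g q := by
    intro p q
    obtain ⟨w⟩ := hG.isPlane.connected.preconnected p q
    induction w with
    | nil => rfl
    | cons h _ ih => exact (hadj _ _ h).trans ih
  obtain ⟨d, hd⟩ : (R.faceDarts outer).Nonempty := by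
    rw [Set.nonempty_iff_ne_empty]
    intro h
    have := hG.three_le_outer
    simp [h] at this
  ext v
  rw [← hgf v, hconst v.1 d.fst, hg0 _ ⟨d, hd, rfl⟩, Pi.zero_apply]

/-- The kernel of the edge-face matrix consists of constants: a function on the inner faces that
does not change along inner edges is constant around each vertex, and so along each edge. -/
theorem IsNearTriangulation.eq_of_mulVec_eq_zero (hG : R.IsNearTriangulation outer)
    [Fintype {f : R.Face // f ≠ outer}] (g : {f : R.Face // f ≠ outer} → ZMod 2)
    (hg : (R.edgeFace outer).mulVec g = 0) (i j) : g i = g j := by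
  have hT := hG.triSurface
  have hs : ∀ {a b}, Inner (R.triangles outer) a b →
      R.faceFun outer g a b = R.faceFun outer g b a := by
    intro a b h
    exact CharTwo.add_eq_zero.1
      ((edgeFace_mulVec g (hG.inner_triangles.1 h)).symm.trans (congrFun hg _))
  have hvert : ∀ {a b}, HasTri (R.triangles outer) a b → ∀ c,
      ((∀ q, HasTri (R.triangles outer) a q → R.faceFun outer g a q = c) ↔
        R.faceFun outer g a b = c) :=
    fun hab c => ⟨fun h => h _ hab, fun h q hq => (hT.face_eq faceFun_triangles hs hq hab).trans h⟩
  have hdart : ∀ d d' : G.Dart, R.faceOf d ≠ outer → R.faceOf d' ≠ outer →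
      R.faceFun outer g d.fst d.snd = R.faceFun outer g d'.fst d'.snd := by
    intro d d' hd hd'
    have hd := hasTri_dart.2 hd
    have hd' := hasTri_dart.2 hd'
    have key := hT.conn (fun a => ∀ q, HasTri (R.triangles outer) a q →
      R.faceFun outer g a q = R.faceFun outer g d'.fst d'.snd) (by
        have main : ∀ a b, HasTri (R.triangles outer) a b →
            ((∀ q, HasTri (R.triangles outer) a q →
              R.faceFun outer g a q = R.faceFun outer g d'.fst d'.snd) ↔
            (∀ q, HasTri (R.triangles outer) b q →
              R.faceFun outer g b q = R.faceFun outer g d'.fst d'.snd)) := by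
          rintro a b ⟨c, h⟩
          rw [hvert ⟨c, h⟩, hvert ⟨a, hT.cyc h⟩, faceFun_triangles h]
        rintro a b (h | h)
        exacts [main a b h, (main b a h).symm]) d.fst d'.fst ⟨_, Or.inl hd⟩ ⟨_, Or.inl hd'⟩
    exact (hvert hd _).1 (key.2 ((hvert hd' _).2 rfl))
  obtain ⟨i, hi⟩ := i
  obtain ⟨j, hj⟩ := j
  induction i using Quotient.inductionOn with
  | _ d =>
  induction j using Quotient.inductionOn with
  | _ d' =>
  have := hdart d d' hi hj
  rwa [faceFun_dart hi, faceFun_dart hj] at this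

open Classical in
/-- The inner faces of a near-triangulation form a triangulated disk. -/
theorem IsNearTriangulation.triDisk (hG : R.IsNearTriangulation outer) :
    TriDisk (R.triangles outer) := by
  refine { hG.triSurface with relHom := fun z hz hs hw => ?_ }
  have hfin : Finite R.Face := Quotient.finite _
  have : Fintype {f : R.Face // f ≠ outer} := Fintype.ofFinite _
  have : Fintype {v // ¬ R.OnBoundary outer v} := Fintype.ofFinite _
  have : Fintype {e // e ∈ G.edgeSet ∧ e ∉ R.boundaryEdges outer} := Fintype.ofFinite _
  have hbd : ∀ e ∈ R.boundaryEdges outer, ∀ v ∈ e, R.OnBoundary outer v := by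
    rintro _ ⟨d, hd, rfl⟩ v hv
    rw [← hG.bdVertex_triangles]
    rcases Sym2.mem_iff.1 hv with rfl | rfl
    exacts [(hG.bd_triangles hd).right, (hG.bd_triangles hd).left]
  have hcard := hG.card_relative
  simp only [Nat.card_eq_fintype_card] at hcard
  obtain ⟨g, hg⟩ := Matrix.exists_mulVec_eq_of_card (vertexEdge_mul_edgeFace hbd)
    (hG.eq_zero_of_vecMul hbd) hG.eq_of_mulVec_eq_zero hcard
    (z := fun e => Sym2.lift ⟨z, hz⟩ e.1) (by
      ext w
      have h1 := hw w.1 (fun h => w.2 (hG.bdVertex_triangles.1 h))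
      rw [Pi.zero_apply, ← h1, eq_comm]
      have hin : ∀ b, z w.1 b ≠ 0 → s(w.1, b) ∈ G.edgeSet ∧ s(w.1, b) ∉ R.boundaryEdges outer :=
        fun b hb => hG.inner_triangles.1 (hs _ _ hb)
      rw [← Finset.sum_filter_ne_zero]
      simp only [Matrix.mulVec, dotProduct, vertexEdge, ite_mul, one_mul, zero_mul]
      rw [← Finset.sum_filter]
      refine Finset.sum_bij_ne_zero (fun b _ hb => ⟨s(w.1, b), hin b hb⟩) ?_ ?_ ?_ ?_
      · intro b _ _
        simp
      · intro b _ _ b' _ _ h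
        exact Sym2.congr_right.1 (Subtype.ext_iff.1 h)
      · rintro ⟨e, he⟩ hwe hne
        simp only [Finset.mem_filter, Finset.mem_univ, true_and] at hwe
        obtain ⟨b, rfl⟩ := hwe
        exact ⟨b, by simpa using hne, by simpa using hne, rfl⟩
      · intro b _ _
        simp)
  refine ⟨R.faceFun outer g, fun a b c h => faceFun_triangles h, fun a b h => ?_⟩
  exact (congrFun hg _).symm.trans (edgeFace_mulVec g (hG.inner_triangles.1 h))

end homology

end RotationSystem

/-! ### Near-triangulations -/

theorem decoratedPoly_eq_prod {V : Type*} [Fintype V] [LinearOrder V] {F : Type*} [Field F]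
    {H : SimpleGraph V} {E : Finset (Sym2 V)} (h : ∀ e, e ∈ E ↔ e ∈ H.edgeSet)
    (a b : Sym2 V → F) : decoratedPoly H a b = ∏ e ∈ E, edgeForm a b e := by
  classical
  refine Finset.prod_congr (Finset.ext fun e => ?_) fun _ _ => rfl
  rw [SimpleGraph.mem_edgeFinset, h]

open TriDisk RotationSystem in
theorem mainTheorem3 {V : Type*} [Fintype V] [LinearOrder V] (G : SimpleGraph V)
    (R : RotationSystem G) (outer : R.Face) (hG : R.IsNearTriangulation outer)
    (x y : V) (hxy : s(x, y) ∈ R.boundaryEdges outer)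
    {F : Type*} [Field F] (a b : Sym2 V → F)
    (hab : ∀ e ∈ (G.deleteEdges {s(x, y)}).edgeSet, a e ≠ 0 ∧ b e ≠ 0) :
    ∃ M : V →₀ ℕ,
      MvPolynomial.coeff M (decoratedPoly (G.deleteEdges {s(x, y)}) a b) ≠ 0 ∧
      (M x = 0 ∧ M y = 0) ∧
      (∀ v : V, R.OnBoundary outer v → M v ≤ 2) ∧
      (∀ u : V, ¬ R.OnBoundary outer u → M u ≤ 4) := by
  classical
  have hE : ∀ e, e ∈ (edges (R.triangles outer)).erase s(x, y) ↔
      e ∈ (G.deleteEdges {s(x, y)}).edgeSet := by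
    intro e
    induction e with
    | _ p q =>
    rw [Finset.mem_erase, mem_edges, hG.adj_triangles, SimpleGraph.mem_edgeSet,
      SimpleGraph.deleteEdges_adj, Set.mem_singleton_iff, and_comm]
  have hab' : ∀ e ∈ (edges (R.triangles outer)).erase s(x, y), a e ≠ 0 ∧ b e ≠ 0 :=
    fun e he => hab e ((hE e).1 he)
  obtain ⟨M, hM⟩ : ∃ M, IsGood a b (R.triangles outer) x y M := by
    obtain ⟨d, hd, he⟩ := hxy
    have hB := hG.bd_triangles hd
    rcases Sym2.eq_iff.1 he with ⟨rfl, rfl⟩ | ⟨rfl, rfl⟩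
    · obtain ⟨M, hM⟩ := exists_isGood _ hG.triDisk rfl hB
        (by rw [Sym2.eq_swap]; exact hab')
      exact ⟨M, hM.symm⟩
    · exact exists_isGood _ hG.triDisk rfl hB hab'
  refine ⟨M, ?_, ⟨hM.left, hM.right⟩, fun v hv => hM.bd v (hG.bdVertex_triangles.2 hv),
    fun u _ => hM.le u⟩
  rw [decoratedPoly_eq_prod hE]
  exact hM.coeff_ne
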